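/- **Theorem 7.2 (Equivariant Nerve Theorem).** Let $G$ be a (discrete) group and let $X$ be a $G$-poset, i.e. a partially ordered set with an order-preserving action of $G$. Its geometric realisation $|X|$ is the simplicial complex (with the weak topology) whose simplices are the nonempty finite chains of $X$, with the induced $G$-action. Let $\mathcal{U}$ be a $G$-cover of $X$: a family of subsets of $X$ such that each $U\in\mathcal{U}$ is closed with respect to $\leqslant$ (if $x\in U$ and $y\leqslant x$ then $y\in U$), $\bigcup_{U\in\mathcal{U}}U=X$, and $gU\in\mathcal{U}$ for all $U\in\mathcal{U}$, $g\in G$. Assume that every $x\in X$ lies in only finitely many members of $\mathcal{U}$. Let $N(\mathcal{U})$ be the nerve of $\mathcal{U}$: the simplicial complex (with the weak topology and the induced $G$-action) whose simplices are the nonempty finite sets $\sigma\subseteq\mathcal{U}$ with $\bigcap_{U\in\sigma}U\neq\emptyset$. For a simplex $\sigma$ let $G_\sigma=\{g\in G: g\sigma=\sigma\}$ be its (setwise) stabiliser. Suppose that $\mathcal{U}$ is $G$-contractible, i.e. for every simplex $\sigma$ of $N(\mathcal{U})$ the realisation $\bigl|\bigcap_{U\in\sigma}U\bigr|$ of the subposet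 $\bigcap_{U\in\sigma}U$ is $G_\sigma$-contractible (that is, $G_\sigma$-homotopy equivalent to a point). Then $N(\mathcal{U})$ is $G$-homotopy equivalent to $|X|$: there are continuous $G$-equivariant maps in both directions whose two composites are homotopic to the identities through $G$-equivariant maps. -/

import Mathlib

open scoped Pointwise

/-- The underlying set of the geometric realisation of an abstract simplicial complex `K` on the
vertex type `ι`, in barycentric coordinates: finitely supported functions `ι → ℝ` that are
nonnegative, have total sum `1`, and whose support is a simplex of `K`. -/
@[ext]
structure Realization {ι : Type*} (K : PreAbstractSimplicialComplex ι) where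
  coord : ι →₀ ℝ
  nonneg : ∀ v, 0 ≤ coord v
  sum_eq_one : (coord.sum fun _ r => r) = 1
  support_mem : coord.support ∈ K

namespace Realization

variable {ι : Type*} (K : PreAbstractSimplicialComplex ι)

/-- The closed simplex of the realisation spanned by a finite set `s` of vertices. -/
def ClosedSimplex (s : Finset ι) : Type _ :=
  {p : Realization K // p.coord.support ⊆ s}

/-- A closed simplex carries the Euclidean topology of its barycentric coordinates. -/
instance (s : Finset ι) : TopologicalSpace (ClosedSimplex K s) :=
  TopologicalSpace.induced (fun p v => p.1.coord v : ClosedSimplex K s → (ι → ℝ)) inferInstance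

/-- The weak (CW) topology on the realisation: a set is open (closed) if and only if its
intersection with every closed simplex is open (closed) in that simplex. -/
instance : TopologicalSpace (Realization K) :=
  ⨆ s : {s : Finset ι // s ∈ K},
    TopologicalSpace.coinduced (fun p : ClosedSimplex K s.1 => p.1) inferInstance

end Realization

/-- The action of `G` on the vertices sends simplices of `K` to simplices of `K`. -/
class IsSimplicialAction (G : Type*) {ι : Type*} [Group G] [MulAction G ι]
    (K : PreAbstractSimplicialComplex ι) : Prop where
  map_mem : ∀ (g : G) (s : Finset ι), s ∈ K → s.map (MulAction.toPerm g).toEmbedding ∈ K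

/-- A simplicial action induces an action on the realisation, linear on each simplex: the
barycentric coordinate of `g • p` at `v` is that of `p` at `g⁻¹ • v`. -/
noncomputable instance Realization.instMulAction {G ι : Type*} [Group G] [MulAction G ι]
    (K : PreAbstractSimplicialComplex ι) [IsSimplicialAction G K] :
    MulAction G (Realization K) where
  smul g p :=
    { coord := Finsupp.equivMapDomain (MulAction.toPerm g) p.coord
      nonneg := fun v => by
        rw [Finsupp.equivMapDomain_apply]
        exact p.nonneg _
      sum_eq_one := by
        rw [Finsupp.equivMapDomain_eq_mapDomain,
          Finsupp.sum_mapDomain_index (fun _ => rfl) (fun _ _ _ => rfl)]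
        exact p.sum_eq_one
      support_mem := IsSimplicialAction.map_mem g _ p.support_mem }
  one_smul p := by
    ext v
    change p.coord ((1 : G)⁻¹ • v) = p.coord v
    rw [inv_one, one_smul]
  mul_smul g h p := by
    ext v
    change p.coord ((g * h)⁻¹ • v) = p.coord (h⁻¹ • g⁻¹ • v)
    rw [mul_inv_rev, mul_smul]

/-- Two spaces with an action of `G` are `G`-homotopy equivalent: there are continuous
`G`-equivariant maps in both directions, whose composites are homotopic to the identities through
`G`-equivariant maps. -/
def GHomotopyEquivalent (G A B : Type*) [TopologicalSpace A] [TopologicalSpace B]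
    [SMul G A] [SMul G B] : Prop :=
  ∃ (f : C(A, B)) (h : C(B, A)),
    (∀ (g : G) (a : A), f (g • a) = g • f a) ∧
    (∀ (g : G) (b : B), h (g • b) = g • h b) ∧
    (∃ F : ContinuousMap.Homotopy (h.comp f) (ContinuousMap.id A),
      ∀ (g : G) (t : unitInterval) (a : A), F (t, g • a) = g • F (t, a)) ∧
    (∃ F : ContinuousMap.Homotopy (f.comp h) (ContinuousMap.id B),
      ∀ (g : G) (t : unitInterval) (b : B), F (t, g • b) = g • F (t, b))

/-- A space with an action of `G` is `G`-contractible if it is `G`-homotopy equivalent to a point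
(with the trivial action). -/
def GContractible (G A : Type*) [TopologicalSpace A] [SMul G A] : Prop :=
  GHomotopyEquivalent G A PUnit.{1}

/-- The simplicial complex of a poset: its simplices are the nonempty finite chains. -/
def orderComplex (X : Type*) [PartialOrder X] : PreAbstractSimplicialComplex X where
  faces := {s | s.Nonempty ∧ IsChain (· ≤ ·) (s : Set X)}
  isRelLowerSet_faces := fun _ hs =>
    ⟨hs.1, fun _ hts ht => ⟨ht, hs.2.mono (Finset.coe_subset.2 hts)⟩⟩

/-- A `G`-poset is a partial order with an action of `G` such that every `g • ·` is
order-preserving, expressed by `CovariantClass`. The action is simplicial on the order complex. -/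
instance {G X : Type*} [Group G] [PartialOrder X] [MulAction G X]
    [CovariantClass G X HSMul.hSMul LE.le] : IsSimplicialAction G (orderComplex X) where
  map_mem g s hs := by
    refine ⟨hs.1.map, ?_⟩
    rw [Finset.coe_map]
    rintro _ ⟨x, hx, rfl⟩ _ ⟨y, hy, rfl⟩ _
    rcases hs.2.total hx hy with h | h
    · exact Or.inl (smul_mono_right g h)
    · exact Or.inr (smul_mono_right g h)

/-- A subset of a `G`-poset that is invariant under a subgroup `H` is an `H`-poset. -/
instance {G X : Type*} [Group G] [PartialOrder X] [MulAction G X]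
    [CovariantClass G X HSMul.hSMul LE.le] (H : Subgroup G) (p : SubMulAction H X) :
    CovariantClass H p HSMul.hSMul LE.le where
  elim h _ _ hxy := smul_mono_right (h : G) (Subtype.coe_le_coe.2 hxy)

/-- A `G`-cover of a `G`-poset `X`: a family of subsets of `X`, each closed under passing to
smaller elements, whose union is `X`, and which is preserved by the action of `G`. -/
structure GCover (G X : Type*) [Group G] [PartialOrder X] [MulAction G X] where
  sets : Set (Set X)
  isLowerSet : ∀ U ∈ sets, IsLowerSet U
  sUnion_eq : ⋃₀ sets = Set.univ
  smul_mem : ∀ (g : G), ∀ U ∈ sets, g • U ∈ sets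

namespace GCover

variable {G X : Type*} [Group G] [PartialOrder X] [MulAction G X]

/-- The nerve of a cover: its simplices are the nonempty finite sets of members of the cover
whose intersection is nonempty. -/
def nerve (𝒰 : GCover G X) : PreAbstractSimplicialComplex (Set X) where
  faces := {σ | σ.Nonempty ∧ (∀ U ∈ σ, U ∈ 𝒰.sets) ∧ (⋂ U ∈ σ, U).Nonempty}
  isRelLowerSet_faces := fun _ hσ =>
    ⟨hσ.1, fun _ hτσ hτ => ⟨hτ, fun U hU => hσ.2.1 U (hτσ hU),
      hσ.2.2.mono (Set.biInter_subset_biInter_left hτσ)⟩⟩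

/-- `G` acts simplicially on the nerve by translating the members of the cover. -/
instance (𝒰 : GCover G X) : IsSimplicialAction G 𝒰.nerve where
  map_mem g σ hσ := by
    obtain ⟨hne, hmem, x, hx⟩ := hσ
    refine ⟨hne.map, ?_, g • x, ?_⟩
    · intro V hV
      obtain ⟨U, hU, rfl⟩ := Finset.mem_map.1 hV
      exact 𝒰.smul_mem g U (hmem U hU)
    · refine Set.mem_iInter₂.2 fun V hV => ?_
      obtain ⟨U, hU, rfl⟩ := Finset.mem_map.1 hV
      exact Set.smul_mem_smul_set (Set.mem_iInter₂.1 hx U hU)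

/-- The stabiliser `G_σ` of a finite set `σ` of subsets of `X`: all `g` with `{g • U | U ∈ σ} = σ`
(the elements of `σ` may be permuted). -/
def simplexStabilizer (G : Type*) {X : Type*} [Group G] [MulAction G X]
    (σ : Finset (Set X)) : Subgroup G :=
  MulAction.stabilizer G (σ : Set (Set X))

/-- The intersection `⋂ U ∈ σ, U`, with its action of the stabiliser of `σ`. -/
def inter (G : Type*) {X : Type*} [Group G] [MulAction G X] (σ : Finset (Set X)) :
    SubMulAction (simplexStabilizer G σ) X where
  carrier := ⋂ U ∈ σ, U
  smul_mem' g x hx := by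
    refine Set.mem_iInter₂.2 fun V hV => ?_
    have hg : (g : G) • (σ : Set (Set X)) = σ := g.2
    rw [← Finset.mem_coe, ← hg] at hV
    obtain ⟨U, hU, rfl⟩ := hV
    exact Set.smul_mem_smul_set (Set.mem_iInter₂.1 hx U hU)

/-- A `G`-cover is `G`-contractible if for every simplex `σ` of its nerve the subposet
`⋂ U ∈ σ, U` (that is, its geometric realisation) is `G_σ`-contractible. -/
def IsGContractible [CovariantClass G X HSMul.hSMul LE.le] (𝒰 : GCover G X) : Prop :=
  ∀ σ ∈ 𝒰.nerve,
    GContractible (simplexStabilizer G σ) (Realization (orderComplex (inter G σ)))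

end GCover

/-! The proof is an equivariant, explicit form of the method of contractible carriers. Let `Q` be a
`G`-poset and let `F q` be closed subspaces of a `G`-space, monotone and equivariant in `q`, each
contractible equivariantly for the stabiliser of `q`. Then there is an equivariant map from `|Q|`
whose value at a point lies in `F q` whenever `q` bounds the support of the point from above
(`exists_carried_map`), and any two equivariant maps with this property are `G`-homotopic
(`gHomotopic_of_carried`). Instead of induction over skeleta, the map applies the contractions of
the vertices of a chain in increasing order, for times read off from the barycentric coordinates.
The largest coordinate gets time `1`, so the result forgets the starting point.

Order the simplices of the nerve by reverse inclusion. The carriers `|⋂ U ∈ σ, U|` give a map `h`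
from the realisation of this poset to `|X|`, and composing it with barycentric subdivision gives `ψ
: N(𝒰) → |X|`. In the other direction `φ` spreads the mass of a vertex `x` over the simplex
`pointStar x` of all members containing `x`, which is finite by the local finiteness of the cover.

Both composites are handled by uniqueness of carried maps. `φ ∘ h` and the canonical map from the
subdivision to `N(𝒰)` are both carried by closed stars; `ψ ∘ φ` and the identity of `|X|` are both
carried by `x ↦ |⋂ U ∈ pointStar x, U|`. -/

namespace PreAbstractSimplicialComplex

variable {ι : Type*} {K : PreAbstractSimplicialComplex ι}

theorem nonempty_of_mem {s : Finset ι} (hs : s ∈ K) : s.Nonempty :=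
  (K.isRelLowerSet_faces hs).1

theorem mem_of_subset {s t : Finset ι} (hs : s ∈ K) (hts : t ⊆ s) (ht : t.Nonempty) : t ∈ K :=
  (K.isRelLowerSet_faces hs).2 hts ht

end PreAbstractSimplicialComplex

namespace Realization

open PreAbstractSimplicialComplex

/-! ### The weak topology: continuity tested on closed simplices. -/

section Basic

variable {ι : Type*} {K : PreAbstractSimplicialComplex ι}

theorem support_nonempty (p : Realization K) : p.coord.support.Nonempty :=
  nonempty_of_mem p.support_mem

theorem coord_pos (p : Realization K) {v : ι} (hv : v ∈ p.coord.support) : 0 < p.coord v :=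
  lt_of_le_of_ne (p.nonneg v) (Finsupp.mem_support_iff.1 hv).symm

theorem mem_support_of_pos (p : Realization K) {v : ι} (hv : 0 < p.coord v) :
    v ∈ p.coord.support :=
  Finsupp.mem_support_iff.2 hv.ne'

theorem sum_coord (p : Realization K) {s : Finset ι} (hs : p.coord.support ⊆ s) :
    ∑ v ∈ s, p.coord v = 1 := by
  rw [← p.sum_eq_one, Finsupp.sum_of_support_subset _ hs _ fun _ _ => rfl]

theorem continuous_closedSimplex_val {s : Finset ι} (hs : s ∈ K) :
    Continuous (fun p : ClosedSimplex K s => p.1) :=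
  continuous_iSup_rng (i := (⟨s, hs⟩ : {s : Finset ι // s ∈ K})) continuous_coinduced_rng

theorem continuous_closedSimplex_coord (s : Finset ι) (v : ι) :
    Continuous (fun p : ClosedSimplex K s => p.1.coord v) :=
  (continuous_apply v).comp
    (continuous_induced_dom : Continuous (fun p v => p.1.coord v : ClosedSimplex K s → ι → ℝ))

theorem continuous_closedSimplex_mk {T : Type*} [TopologicalSpace T] {s : Finset ι}
    {f : T → ClosedSimplex K s} (hf : ∀ v, Continuous fun t => (f t).1.coord v) : Continuous f :=
  continuous_induced_rng.2 (continuous_pi hf)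

theorem continuous_iff {Z : Type*} [TopologicalSpace Z] {f : Realization K → Z} :
    Continuous f ↔ ∀ s ∈ K, Continuous fun p : ClosedSimplex K s => f p.1 := by
  refine ⟨fun hf s hs => hf.comp (continuous_closedSimplex_val hs), fun h => ?_⟩
  refine continuous_iSup_dom.2 fun s => ?_
  exact continuous_coinduced_dom.2 (h s.1 s.2)

theorem isClosed_iff {C : Set (Realization K)} :
    IsClosed C ↔ ∀ s ∈ K, IsClosed ((fun p : ClosedSimplex K s => p.1) ⁻¹' C) := by
  refine ⟨fun hC s hs => hC.preimage (continuous_closedSimplex_val hs), fun h => ?_⟩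
  refine isClosed_iSup_iff.2 fun s => isClosed_coinduced.2 (h s.1 s.2)

theorem continuous_coord (v : ι) : Continuous fun p : Realization K => p.coord v :=
  continuous_iff.2 fun s _ => continuous_closedSimplex_coord s v

theorem isClosed_support_subset (S : Set ι) :
    IsClosed {p : Realization K | ∀ v ∈ p.coord.support, v ∈ S} := by
  have : {p : Realization K | ∀ v ∈ p.coord.support, v ∈ S} =
      ⋂ v ∈ Sᶜ, {p : Realization K | p.coord v = 0} := by
    ext p
    simp only [Set.mem_ofPred_eq, Set.mem_iInter, Finsupp.mem_support_iff, Set.mem_compl_iff]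
    exact forall_congr' fun v => not_imp_comm
  rw [this]
  exact isClosed_biInter fun v _ => isClosed_eq (continuous_coord v) continuous_const

/-- A map into a realisation whose image involves only finitely many vertices is continuous as soon
as its barycentric coordinates are. -/
theorem continuous_of_coord {T : Type*} [TopologicalSpace T] {f : T → Realization K}
    (S : Finset ι) (hS : ∀ t, (f t).coord.support ⊆ S)
    (hf : ∀ v, Continuous fun t => (f t).coord v) : Continuous f := by
  classical
  let C : {s : Finset ι // s ∈ S.powerset ∧ s ∈ K} → Set T := fun s =>
    {t | (f t).coord.support ⊆ s.1}
  have hfin : Finite {s : Finset ι // s ∈ S.powerset ∧ s ∈ K} :=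
    Set.Finite.subset S.powerset.finite_toSet fun s hs => hs.1
  have hC : ∀ s, IsClosed (C s) := by
    intro s
    have : C s = ⋂ v ∈ (s.1 : Set ι)ᶜ, {t | (f t).coord v = 0} := by
      ext t
      simp only [C, Set.mem_ofPred_eq, Set.mem_iInter, Set.mem_compl_iff, Finset.mem_coe,
        Finset.subset_iff, Finsupp.mem_support_iff]
      exact forall_congr' fun v => not_imp_comm
    rw [this]
    exact isClosed_biInter fun v _ => isClosed_eq (hf v) continuous_const
  -- The sets `C s`, for the finitely many simplices inside `S`, form a closed cover, and on each of
  -- them `f` factors through a closed simplex.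
  refine (locallyFinite_of_finite C).continuous ?_ hC ?_
  · refine Set.eq_univ_of_forall fun t => Set.mem_iUnion.2
      ⟨⟨(f t).coord.support, Finset.mem_powerset.2 (hS t), (f t).support_mem⟩, ?_⟩
    exact Finset.Subset.refl _
  · intro s
    rw [continuousOn_iff_continuous_domRestrict]
    have : (C s).domRestrict f =
        (fun p : ClosedSimplex K s.1 => p.1) ∘ fun t : C s => ⟨f t.1, t.2⟩ := rfl
    rw [this]
    exact (continuous_closedSimplex_val s.2.2).comp
      (continuous_closedSimplex_mk fun v => (hf v).comp continuous_subtype_val)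

/-- Homotopies defined on a realisation are continuous if they are so on closed simplices. -/
theorem continuous_homotopy {Z : Type*} [TopologicalSpace Z]
    {f : unitInterval × Realization K → Z}
    (hf : ∀ s ∈ K, Continuous fun x : unitInterval × ClosedSimplex K s => f (x.1, x.2.1)) :
    Continuous f := by
  have hpt : ∀ p : Realization K, Continuous fun t : unitInterval => f (t, p) := fun p => by
    let p' : ClosedSimplex K p.coord.support := ⟨p, Finset.Subset.refl _⟩
    exact (hf _ p.support_mem).comp (Continuous.prodMk_left p')
  -- Currying moves the interval into the target, so that the weak topology can be tested one
  -- simplex at a time; uncurrying back uses that the interval is locally compact.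
  let g : Realization K → C(unitInterval, Z) := fun p => ⟨fun t => f (t, p), hpt p⟩
  have hg : Continuous g := by
    refine continuous_iff.2 fun s hs => ?_
    exact ContinuousMap.continuous_of_continuous_uncurry _ ((hf s hs).comp continuous_swap)
  exact (ContinuousMap.continuous_uncurry_of_continuous ⟨g, hg⟩).comp continuous_swap

end Basic

/-! ### Points of a realisation given by unnormalised weights. -/

section OfWeights

variable {ι : Type*} {K : PreAbstractSimplicialComplex ι}

/-- Nonnegative weights, not all zero, that vanish outside some simplex of `K`. -/
structure IsWeight (K : PreAbstractSimplicialComplex ι) (w : ι → ℝ) : Prop where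
  nonneg : ∀ v, 0 ≤ w v
  exists_ne : ∃ v, w v ≠ 0
  exists_mem : ∃ s ∈ K, ∀ v, w v ≠ 0 → v ∈ s

namespace IsWeight

variable {w : ι → ℝ}

theorem finite_support (h : IsWeight K w) : (Function.support w).Finite := by
  obtain ⟨s, _, hs⟩ := h.exists_mem
  exact s.finite_toSet.subset hs

theorem finsum_pos (h : IsWeight K w) : 0 < ∑ᶠ v, w v := by
  obtain ⟨v, hv⟩ := h.exists_ne
  exact _root_.finsum_pos h.nonneg ⟨v, lt_of_le_of_ne (h.nonneg v) hv.symm⟩ h.finite_support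

end IsWeight

/-- The point of the realisation whose barycentric coordinates are proportional to the given
weights. -/
noncomputable def ofWeights (w : ι → ℝ) (h : IsWeight K w) : Realization K where
  coord := (∑ᶠ v, w v)⁻¹ • Finsupp.ofSupportFinite w h.finite_support
  nonneg v := mul_nonneg (inv_nonneg.2 h.finsum_pos.le) (h.nonneg v)
  sum_eq_one := by
    rw [Finsupp.sum_smul_index' fun _ => rfl, Finsupp.sum]
    simp only [smul_eq_mul]
    rw [← Finset.mul_sum, inv_mul_eq_one₀ h.finsum_pos.ne',
      finsum_eq_sum_of_support_subset w (s := (Finsupp.ofSupportFinite w h.finite_support).support)]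
    · rfl
    · rw [Finsupp.ofSupportFinite_support]
      simp
  support_mem := by
    obtain ⟨s, hsK, hs⟩ := h.exists_mem
    rw [Finsupp.support_smul_eq (inv_ne_zero h.finsum_pos.ne')]
    refine mem_of_subset hsK (fun v hv => hs v (Finsupp.mem_support_iff.1 hv)) ?_
    obtain ⟨v, hv⟩ := h.exists_ne
    exact ⟨v, Finsupp.mem_support_iff.2 hv⟩

theorem ofWeights_coord {w : ι → ℝ} (h : IsWeight K w) (v : ι) :
    (ofWeights w h).coord v = (∑ᶠ v, w v)⁻¹ * w v := rfl

theorem mem_support_ofWeights {w : ι → ℝ} (h : IsWeight K w) {v : ι} :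
    v ∈ (ofWeights w h).coord.support ↔ w v ≠ 0 := by
  rw [Finsupp.mem_support_iff, ofWeights_coord, mul_ne_zero_iff,
    and_iff_right (inv_ne_zero h.finsum_pos.ne')]

theorem ofWeights_coord_le {w : ι → ℝ} (h : IsWeight K w) {u v : ι} :
    (ofWeights w h).coord u ≤ (ofWeights w h).coord v ↔ w u ≤ w v := by
  rw [ofWeights_coord, ofWeights_coord]
  exact mul_le_mul_iff_right₀ (inv_pos.2 h.finsum_pos)

theorem finsum_coord (p : Realization K) : ∑ᶠ v, p.coord v = 1 := by
  rw [finsum_eq_sum_of_support_subset p.coord (s := p.coord.support) (by simp)]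
  exact p.sum_coord subset_rfl

theorem ofWeights_eq {w : ι → ℝ} (h : IsWeight K w) (p : Realization K)
    (hp : ∀ v, w v = p.coord v) : ofWeights w h = p := by
  obtain rfl : w = p.coord := funext hp
  ext v
  rw [ofWeights_coord, p.finsum_coord, inv_one, one_mul]

theorem continuous_ofWeights {T : Type*} [TopologicalSpace T] {w : T → ι → ℝ}
    (h : ∀ t, IsWeight K (w t)) (S : Finset ι) (hS : ∀ t v, w t v ≠ 0 → v ∈ S)
    (hw : ∀ v, Continuous fun t => w t v) : Continuous fun t => ofWeights (w t) (h t) := by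
  refine continuous_of_coord S (fun t v hv => hS t v ((mem_support_ofWeights _).1 hv)) fun v => ?_
  simp only [ofWeights_coord]
  refine Continuous.mul (Continuous.inv₀ ?_ fun t => (h t).finsum_pos.ne') (hw v)
  have : (fun t => ∑ᶠ v, w t v) = fun t => ∑ v ∈ S, w t v :=
    funext fun t => finsum_eq_sum_of_support_subset _ fun v hv => hS t v hv
  rw [this]
  exact continuous_finsetSum _ fun v _ => hw v

end OfWeights

/-! ### The induced action on a realisation. -/

section Action

variable {G ι : Type*} [Group G] [MulAction G ι] {K : PreAbstractSimplicialComplex ι}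
  [IsSimplicialAction G K]

theorem smul_coord (g : G) (p : Realization K) (v : ι) :
    (g • p).coord v = p.coord (g⁻¹ • v) := rfl

theorem smul_coord_smul (g : G) (p : Realization K) (v : ι) :
    (g • p).coord (g • v) = p.coord v := by
  rw [smul_coord, inv_smul_smul]

theorem support_smul (g : G) (p : Realization K) :
    (g • p).coord.support = p.coord.support.map (MulAction.toPerm g).toEmbedding := by
  ext v
  rw [Finset.mem_map_equiv, Finsupp.mem_support_iff, Finsupp.mem_support_iff, smul_coord]
  rfl

theorem mem_support_smul {g : G} {p : Realization K} {v : ι} :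
    v ∈ (g • p).coord.support ↔ g⁻¹ • v ∈ p.coord.support := by
  rw [Finsupp.mem_support_iff, Finsupp.mem_support_iff, smul_coord]

theorem smul_ofWeights (g : G) {w w' : ι → ℝ} (h : IsWeight K w) (h' : IsWeight K w')
    (hw : ∀ v, w' (g • v) = w v) : g • ofWeights w h = ofWeights w' h' := by
  ext v
  rw [smul_coord, ofWeights_coord, ofWeights_coord, ← hw, smul_inv_smul,
    ← finsum_comp_equiv (MulAction.toPerm g) (f := w')]
  simp only [MulAction.toPerm_apply, hw]

instance : ContinuousConstSMul G (Realization K) where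
  continuous_const_smul g := continuous_iff.2 fun s hs => by
    refine continuous_of_coord (s.map (MulAction.toPerm g).toEmbedding) (fun p => ?_) fun v => ?_
    · rw [support_smul]
      exact Finset.map_subset_map.2 p.2
    · exact continuous_closedSimplex_coord s (g⁻¹ • v)

end Action

/-! ### Subcomplexes as closed subspaces. -/

section Embedding

variable {ι ι' : Type*} {K' : PreAbstractSimplicialComplex ι'}
  {K : PreAbstractSimplicialComplex ι}

/-- The inclusion of realisations induced by an embedding of simplicial complexes. -/
noncomputable def mapEmbedding (e : ι' ↪ ι) (he : ∀ s ∈ K', s.map e ∈ K) (p : Realization K') :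
    Realization K where
  coord := p.coord.embDomain e
  nonneg v := by
    by_cases hv : v ∈ Set.range e
    · obtain ⟨u, rfl⟩ := hv
      rw [Finsupp.embDomain_apply_self]
      exact p.nonneg u
    · rw [Finsupp.embDomain_of_notMem_range _ _ _ hv]
  sum_eq_one := by
    rw [Finsupp.sum_embDomain]
    exact p.sum_eq_one
  support_mem := by
    rw [Finsupp.support_embDomain]
    exact he _ p.support_mem

variable (e : ι' ↪ ι) (he : ∀ s ∈ K', s.map e ∈ K)

theorem mapEmbedding_coord (p : Realization K') (v : ι') :
    (mapEmbedding e he p).coord (e v) = p.coord v :=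
  Finsupp.embDomain_apply_self _ _ _

theorem mapEmbedding_coord_notMem (p : Realization K') {v : ι} (hv : v ∉ Set.range e) :
    (mapEmbedding e he p).coord v = 0 :=
  Finsupp.embDomain_of_notMem_range _ _ _ hv

theorem support_mapEmbedding (p : Realization K') :
    (mapEmbedding e he p).coord.support = p.coord.support.map e :=
  Finsupp.support_embDomain _ _

theorem mapEmbedding_injective : Function.Injective (mapEmbedding e he) := by
  intro p q hpq
  ext v
  rw [← mapEmbedding_coord e he, hpq, mapEmbedding_coord]

theorem mem_range_mapEmbedding {q : Realization K} :
    q ∈ Set.range (mapEmbedding e he) ↔ ∃ s ∈ K', s.map e = q.coord.support := by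
  constructor
  · rintro ⟨p, rfl⟩
    exact ⟨_, p.support_mem, (support_mapEmbedding e he p).symm⟩
  · rintro ⟨s, hs, hq⟩
    have hne : ∀ v, q.coord (e v) ≠ 0 ↔ v ∈ s := fun v => by
      rw [← Finsupp.mem_support_iff, ← hq, Finset.mem_map' e]
    have hw : IsWeight K' fun v => q.coord (e v) :=
      ⟨fun v => q.nonneg _, (nonempty_of_mem hs).imp fun v hv => (hne v).2 hv,
        s, hs, fun v => (hne v).1⟩
    have hsum : ∑ᶠ v, q.coord (e v) = 1 := by
      rw [finsum_eq_sum_of_support_subset _ (s := s) fun v hv => (hne v).1 hv,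
        ← Finset.sum_map s e fun v => q.coord v]
      exact q.sum_coord hq.ge
    refine ⟨ofWeights _ hw, ?_⟩
    ext v
    by_cases hv : v ∈ Set.range e
    · obtain ⟨u, rfl⟩ := hv
      rw [mapEmbedding_coord, ofWeights_coord, hsum, inv_one, one_mul]
    · rw [mapEmbedding_coord_notMem e he _ hv, eq_comm, ← Finsupp.notMem_support_iff, ← hq]
      exact fun h => hv (by obtain ⟨u, _, rfl⟩ := Finset.mem_map.1 h; exact ⟨u, rfl⟩)

theorem continuous_mapEmbedding : Continuous (mapEmbedding e he) := by
  refine continuous_iff.2 fun s hs => continuous_of_coord (s.map e) (fun p => ?_) fun v => ?_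
  · rw [support_mapEmbedding]
    exact Finset.map_subset_map.2 p.2
  · by_cases hv : v ∈ Set.range e
    · obtain ⟨u, rfl⟩ := hv
      simp only [mapEmbedding_coord]
      exact continuous_closedSimplex_coord s u
    · simp only [mapEmbedding_coord_notMem e he _ hv]
      exact continuous_const

/-- The intrinsic weak topology of a subcomplex agrees with its subspace topology. This turns
contractions of separate realisations into contractions of closed subspaces of one fixed space. -/
theorem isClosedEmbedding_mapEmbedding :
    Topology.IsClosedEmbedding (mapEmbedding e he) := by
  classical
  refine .of_continuous_injective_isClosedMap (continuous_mapEmbedding e he)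
    (mapEmbedding_injective e he) fun C hC => isClosed_iff.2 fun s hs => ?_
  -- the part of the image in a closed simplex is a finite union of images of faces
  let D : {t : Finset ι' // t ∈ (s.preimage e e.injective.injOn).powerset ∧ t ∈ K'} →
      Set (ClosedSimplex K s) := fun t =>
    (fun p => p.1) ⁻¹' (mapEmbedding e he '' (C ∩ {p | p.coord.support ⊆ t.1}))
  have hfin : Finite {t : Finset ι' //
      t ∈ (s.preimage e e.injective.injOn).powerset ∧ t ∈ K'} :=
    Set.Finite.subset (s.preimage e e.injective.injOn).powerset.finite_toSet fun t ht => ht.1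
  have hD : (fun p : ClosedSimplex K s => p.1) ⁻¹' (mapEmbedding e he '' C) = ⋃ t, D t := by
    ext p
    simp only [Set.mem_preimage, Set.mem_iUnion, D]
    constructor
    · rintro ⟨q, hq, hqp⟩
      refine ⟨⟨q.coord.support, Finset.mem_powerset.2 fun v hv => ?_, q.support_mem⟩, q,
        ⟨hq, Finset.Subset.refl _⟩, hqp⟩
      rw [Finset.mem_preimage]
      refine p.2 ?_
      rw [← hqp, support_mapEmbedding]
      exact Finset.mem_map_of_mem e hv
    · rintro ⟨t, q, hq, hqp⟩
      exact ⟨q, hq.1, hqp⟩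
  rw [hD]
  refine isClosed_iUnion_of_finite fun t => ?_
  let A : Set (ClosedSimplex K s) := {p | p.1.coord.support ⊆ t.1.map e}
  have hA : IsClosed A := (isClosed_support_subset (K := K) (t.1.map e : Set ι)).preimage
    (continuous_closedSimplex_val hs)
  have hex : ∀ p : A, ∃ q : Realization K', mapEmbedding e he q = p.1.1 := by
    intro p
    refine (mem_range_mapEmbedding e he).2 ⟨p.1.1.coord.support.preimage e e.injective.injOn, ?_, ?_⟩
    · refine mem_of_subset t.2.2 (fun v hv => ?_) ?_
      · exact (Finset.mem_map' e).1 (p.2 (Finset.mem_preimage.1 hv))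
      · obtain ⟨v, hv⟩ := p.1.1.support_nonempty
        obtain ⟨u, _, rfl⟩ := Finset.mem_map.1 (p.2 hv)
        exact ⟨u, Finset.mem_preimage.2 hv⟩
    · ext v
      simp only [Finset.mem_map, Finset.mem_preimage]
      constructor
      · rintro ⟨u, hu, rfl⟩
        exact hu
      · intro hv
        obtain ⟨u, _, rfl⟩ := Finset.mem_map.1 (p.2 hv)
        exact ⟨u, hv, rfl⟩
  -- `r` inverts the embedding over the face `t`. Its coordinates are continuous and supported in
  -- `t`, so it is continuous, and `D t` is the preimage of `C` under it.
  choose r hr using hex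
  have hrsupp : ∀ p : A, (r p).coord.support ⊆ t.1 := fun p => by
    have : (mapEmbedding e he (r p)).coord.support ⊆ t.1.map e := by
      rw [hr]
      exact p.2
    rw [support_mapEmbedding] at this
    exact Finset.map_subset_map.1 this
  have hrcont : Continuous r := by
    refine continuous_of_coord t.1 hrsupp fun v => ?_
    have : (fun p => (r p).coord v) = fun p : A => p.1.1.coord (e v) :=
      funext fun p => by rw [← hr p, mapEmbedding_coord]
    rw [this]
    exact (continuous_closedSimplex_coord s (e v)).comp continuous_subtype_val
  have hDt : D t = Subtype.val '' (r ⁻¹' C) := by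
    ext p
    constructor
    · rintro ⟨q, hq, hqp⟩
      have hpA : p ∈ A := by
        have hsupp := (support_mapEmbedding e he q).trans_subset (Finset.map_subset_map.2 hq.2)
        rwa [hqp] at hsupp
      refine ⟨⟨p, hpA⟩, ?_, rfl⟩
      have : r ⟨p, hpA⟩ = q := mapEmbedding_injective e he ((hr _).trans hqp.symm)
      rw [Set.mem_preimage, this]
      exact hq.1
    · rintro ⟨p, hp, rfl⟩
      exact ⟨r p, ⟨hp, hrsupp p⟩, hr p⟩
  rw [hDt]
  exact (hA.isClosedEmbedding_subtypeVal.isClosedMap _) (hC.preimage hrcont)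

theorem mapEmbedding_smul {S G : Type*} [Group S] [Group G] [MulAction S ι'] [MulAction G ι]
    [IsSimplicialAction S K'] [IsSimplicialAction G K] {g' : S} {g : G}
    (hg : ∀ v, e (g' • v) = g • e v) (p : Realization K') :
    mapEmbedding e he (g' • p) = g • mapEmbedding e he p := by
  ext v
  obtain ⟨v, rfl⟩ : ∃ u, g • u = v := MulAction.surjective g v
  rw [smul_coord_smul]
  by_cases hv : v ∈ Set.range e
  · obtain ⟨u, rfl⟩ := hv
    rw [← hg, mapEmbedding_coord, mapEmbedding_coord, smul_coord_smul]
  · rw [mapEmbedding_coord_notMem e he p hv, mapEmbedding_coord_notMem]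
    rintro ⟨u, hu⟩
    refine hv ⟨g'⁻¹ • u, MulAction.injective g ?_⟩
    change g • e _ = g • v
    rw [← hg, smul_inv_smul, hu]

end Embedding

end Realization

/-! ### Equivariant homotopies, including straight-line ones. -/

/-- Two continuous maps are `G`-homotopic if they are homotopic through `G`-equivariant maps. -/
def GHomotopic (G : Type*) {A B : Type*} [TopologicalSpace A] [TopologicalSpace B]
    [SMul G A] [SMul G B] (f₀ f₁ : C(A, B)) : Prop :=
  ∃ F : ContinuousMap.Homotopy f₀ f₁,
    ∀ (g : G) (t : unitInterval) (a : A), F (t, g • a) = g • F (t, a)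

namespace GHomotopic

variable {G A B C : Type*} [TopologicalSpace A] [TopologicalSpace B] [TopologicalSpace C]
  [SMul G A] [SMul G B] [SMul G C]

theorem symm {f₀ f₁ : C(A, B)} (h : GHomotopic G f₀ f₁) : GHomotopic G f₁ f₀ := by
  obtain ⟨F, hF⟩ := h
  refine ⟨F.symm, fun g t a => ?_⟩
  simp only [ContinuousMap.Homotopy.symm_apply, hF]

theorem trans {f₀ f₁ f₂ : C(A, B)} (h : GHomotopic G f₀ f₁) (h' : GHomotopic G f₁ f₂) :
    GHomotopic G f₀ f₂ := by
  obtain ⟨F, hF⟩ := h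
  obtain ⟨F', hF'⟩ := h'
  refine ⟨F.trans F', fun g t a => ?_⟩
  simp only [ContinuousMap.Homotopy.trans_apply]
  split_ifs
  · exact hF _ _ _
  · exact hF' _ _ _

theorem comp_left {f₀ f₁ : C(A, B)} (h : GHomotopic G f₀ f₁) (k : C(B, C))
    (hk : ∀ (g : G) (b : B), k (g • b) = g • k b) :
    GHomotopic G (k.comp f₀) (k.comp f₁) := by
  obtain ⟨F, hF⟩ := h
  refine ⟨⟨⟨fun x => k (F x), by fun_prop⟩, fun a => ?_, fun a => ?_⟩, fun g t a => ?_⟩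
  · simp
  · simp
  · change k (F (t, g • a)) = g • k (F (t, a))
    rw [hF, hk]

theorem comp_right {f₀ f₁ : C(B, C)} (h : GHomotopic G f₀ f₁) (k : C(A, B))
    (hk : ∀ (g : G) (a : A), k (g • a) = g • k a) :
    GHomotopic G (f₀.comp k) (f₁.comp k) := by
  obtain ⟨F, hF⟩ := h
  refine ⟨⟨⟨fun x => F (x.1, k x.2), by fun_prop⟩, fun a => ?_, fun a => ?_⟩, fun g t a => ?_⟩
  · simp
  · simp
  · change F (t, k (g • a)) = g • F (t, k a)
    rw [hk, hF]

end GHomotopic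

namespace Realization

variable {G ι : Type*} [Group G] [MulAction G ι] {K : PreAbstractSimplicialComplex ι}
  [IsSimplicialAction G K]

theorem isWeight_line {p q : Realization K} (t : unitInterval)
    (h : ∃ s ∈ K, p.coord.support ⊆ s ∧ q.coord.support ⊆ s) :
    IsWeight K fun v => (1 - (t : ℝ)) * p.coord v + t * q.coord v := by
  have ht := t.2
  have hnn : ∀ v, 0 ≤ (1 - (t : ℝ)) * p.coord v + t * q.coord v := fun v =>
    add_nonneg (mul_nonneg (sub_nonneg.2 ht.2) (p.nonneg v)) (mul_nonneg ht.1 (q.nonneg v))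
  obtain ⟨s, hs, hp, hq⟩ := h
  refine ⟨hnn, ?_, s, hs, fun v hv => ?_⟩
  · by_contra! h0
    have h1 : ∑ v ∈ s, ((1 - (t : ℝ)) * p.coord v + t * q.coord v) = 1 := by
      rw [Finset.sum_add_distrib, ← Finset.mul_sum, ← Finset.mul_sum, p.sum_coord hp,
        q.sum_coord hq]
      ring
    simp [h0] at h1
  · by_contra hvs
    rw [Finsupp.notMem_support_iff.1 fun h => hvs (hp h),
      Finsupp.notMem_support_iff.1 fun h => hvs (hq h)] at hv
    simp at hv

/-- The straight-line homotopy from the identity to an equivariant map `u` such that every point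
`p` lies in a common simplex with `u p`. -/
theorem gHomotopic_id (u : C(Realization K, Realization K))
    (hu : ∀ (g : G) p, u (g • p) = g • u p)
    (hmem : ∀ p, ∃ s ∈ K, p.coord.support ⊆ s ∧ (u p).coord.support ⊆ s)
    (hfin : ∀ s ∈ K, ∃ S : Finset ι, ∀ p : Realization K, p.coord.support ⊆ s →
      (u p).coord.support ⊆ S) :
    GHomotopic G (ContinuousMap.id _) u := by
  classical
  let F : unitInterval × Realization K → Realization K := fun x =>
    ofWeights _ (isWeight_line x.1 (hmem x.2))
  have hF : Continuous F := by
    refine continuous_homotopy fun s hs => ?_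
    -- Continuous coordinates alone do not give continuity into the weak topology; the finite set `s
    -- ∪ S` confines the whole homotopy over `s`.
    obtain ⟨S, hS⟩ := hfin s hs
    refine continuous_ofWeights _ (s ∪ S) (fun x v hv => ?_) fun v => ?_
    · by_contra hvS
      rw [Finset.mem_union, not_or] at hvS
      rw [Finsupp.notMem_support_iff.1 fun h => hvS.1 (x.2.2 h),
        Finsupp.notMem_support_iff.1 fun h => hvS.2 (hS _ x.2.2 h)] at hv
      simp at hv
    · have h1 : Continuous fun x : unitInterval × ClosedSimplex K s => (x.1 : ℝ) :=
        continuous_subtype_val.comp continuous_fst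
      have h2 : Continuous fun x : unitInterval × ClosedSimplex K s => x.2.1.coord v :=
        (continuous_closedSimplex_coord s v).comp continuous_snd
      have h3 : Continuous fun x : unitInterval × ClosedSimplex K s => (u x.2.1).coord v :=
        (continuous_coord v).comp
          (u.continuous.comp ((continuous_closedSimplex_val hs).comp continuous_snd))
      exact ((continuous_const.sub h1).mul h2).add (h1.mul h3)
  refine ⟨⟨⟨F, hF⟩, fun p => ?_, fun p => ?_⟩, fun g t p => ?_⟩
  · exact ofWeights_eq (isWeight_line 0 (hmem p)) _ fun v => by simp
  · exact ofWeights_eq (isWeight_line 1 (hmem p)) _ fun v => by simp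
  · refine (smul_ofWeights g (isWeight_line t (hmem p)) (isWeight_line t (hmem (g • p)))
      fun v => ?_).symm
    simp only [hu, smul_coord_smul]

end Realization

/-! ### Equivariant families of contractions. -/

/-- A family of contractions `H q` of the subspaces `F q` of `Y`, compatible with the action of
`G`. The contraction starts at the identity, is extended by the identity outside `F q`, and ends at
a constant map. -/
structure IsEquivariantContraction (G : Type*) {Q Y : Type*} [Group G] [MulAction G Q]
    [TopologicalSpace Y] [MulAction G Y] (F : Q → Set Y) (H : Q → ℝ → Y → Y) : Prop where
  nonempty : ∀ q, (F q).Nonempty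
  mapsTo : ∀ q s, Set.MapsTo (H q s) (F q) (F q)
  apply_of_notMem : ∀ q s, ∀ y ∉ F q, H q s y = y
  zero : ∀ q y, H q 0 y = y
  one : ∀ q, ∀ y ∈ F q, ∀ y' ∈ F q, H q 1 y = H q 1 y'
  continuousOn : ∀ q, ContinuousOn (Function.uncurry (H q)) (Set.univ ×ˢ F q)
  smul : ∀ (g : G) q s y, H (g • q) s (g • y) = g • H q s y

section Contraction

variable {G Q Y : Type*} [Group G] [MulAction G Q] [TopologicalSpace Y] [MulAction G Y]

/-- Conjugating the contraction of `A` by `j` yields a contraction inside `Y`. Values outside the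
range of `j` are arbitrary here and are replaced by the identity later. -/
theorem exists_contraction_of_isClosedEmbedding {S : Subgroup G} {A : Type*} [TopologicalSpace A]
    [SMul S A] (hA : GContractible S A) {j : A → Y} (hj : Topology.IsClosedEmbedding j)
    (hjS : ∀ (g : S) a, j (g • a) = (g : G) • j a) :
    ∃ H : ℝ → Y → Y, (Set.range j).Nonempty ∧
      (∀ s, Set.MapsTo (H s) (Set.range j) (Set.range j)) ∧
      (∀ y ∈ Set.range j, H 0 y = y) ∧
      (∀ y ∈ Set.range j, ∀ y' ∈ Set.range j, H 1 y = H 1 y') ∧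
      ContinuousOn (Function.uncurry H) (Set.univ ×ˢ Set.range j) ∧
      ∀ g ∈ S, ∀ s, ∀ y ∈ Set.range j, H s (g • y) = g • H s y := by
  obtain ⟨f, h, _, _, ⟨C, hC⟩, _⟩ := hA
  have : Nonempty A := ⟨h PUnit.unit⟩
  -- The homotopy `C` ends at the identity, whereas contractions are to start there, so time is
  -- reversed; clamping extends it to all real parameters.
  let τ : ℝ → unitInterval := fun s => unitInterval.symm (Set.projIcc 0 1 zero_le_one s)
  have hτ : Continuous τ := unitInterval.continuous_symm.comp continuous_projIcc
  let H : ℝ → Y → Y := fun s y => j (C (τ s, Function.invFun j y))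
  have hH : ∀ s a, H s (j a) = j (C (τ s, a)) := fun s a => by
    simp only [H, Function.leftInverse_invFun hj.injective a]
  have hτ0 : τ 0 = 1 := by simp [τ]
  have hτ1 : τ 1 = 0 := by simp [τ]
  refine ⟨H, Set.range_nonempty j, ?_, ?_, ?_, ?_, ?_⟩
  · rintro s _ ⟨a, rfl⟩
    exact ⟨_, (hH s a).symm⟩
  · rintro _ ⟨a, rfl⟩
    rw [hH, hτ0]
    simp
  · rintro _ ⟨a, rfl⟩ _ ⟨b, rfl⟩
    rw [hH, hH, hτ1]
    simp
  · have hinv : Continuous fun y : Set.range j => Function.invFun j y.1 := by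
      refine hj.isInducing.continuous_iff.2 ?_
      have : (j ∘ fun y : Set.range j => Function.invFun j y.1) = Subtype.val :=
        funext fun y => Function.invFun_eq y.2
      rw [this]
      exact continuous_subtype_val
    rw [continuousOn_iff_continuous_domRestrict]
    have hr : Continuous fun x : (Set.univ ×ˢ Set.range j : Set (ℝ × Y)) =>
        Function.invFun j x.1.2 :=
      hinv.comp (Continuous.subtype_mk (continuous_snd.comp continuous_subtype_val)
        fun x => x.2.2)
    exact hj.continuous.comp (C.continuous.comp
      ((hτ.comp (continuous_fst.comp continuous_subtype_val)).prodMk hr))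
  · rintro g hg s _ ⟨a, rfl⟩
    have := hjS ⟨g, hg⟩ a
    rw [← this, hH, hH, hC, hjS]

/-- Contractions of the members of an equivariant family that are equivariant for the respective
stabilisers can be chosen compatibly with the action of the whole group. -/
theorem exists_isEquivariantContraction [ContinuousConstSMul G Y] (F : Q → Set Y)
    (hF : ∀ (g : G) q, ∀ y ∈ F q, g • y ∈ F (g • q))
    (hloc : ∀ q, ∃ H : ℝ → Y → Y, (F q).Nonempty ∧ (∀ s, Set.MapsTo (H s) (F q) (F q)) ∧
      (∀ y ∈ F q, H 0 y = y) ∧ (∀ y ∈ F q, ∀ y' ∈ F q, H 1 y = H 1 y') ∧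
      ContinuousOn (Function.uncurry H) (Set.univ ×ˢ F q) ∧
      ∀ g : G, g • q = q → ∀ s, ∀ y ∈ F q, H s (g • y) = g • H s y) :
    ∃ H : Q → ℝ → Y → Y, IsEquivariantContraction G F H := by
  classical
  choose H₀ hne hmaps h0 h1 hcont hsmul using hloc
  have hF' : ∀ (g : G) q y, g • y ∈ F (g • q) ↔ y ∈ F q := fun g q y =>
    ⟨fun h => by simpa using hF g⁻¹ _ _ h, hF g q y⟩
  -- Only the contraction at one representative of each orbit is kept; a chosen `γ q` carries it to
  -- `q` by conjugation.
  let rep : Q → Q := fun q => (Quotient.mk (MulAction.orbitRel G Q) q).out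
  have hrep : ∀ (g : G) q, rep (g • q) = rep q := fun g q => by
    have : Quotient.mk (MulAction.orbitRel G Q) (g • q) = Quotient.mk _ q :=
      Quotient.sound ⟨g, rfl⟩
    simp only [rep, this]
  have hγ : ∀ q, ∃ g : G, g • rep q = q := fun q => by
    have : (MulAction.orbitRel G Q) (rep q) q := Quotient.mk_out (s := MulAction.orbitRel G Q) q
    exact (MulAction.orbitRel G Q).symm this
  choose γ hγ using hγ
  have hγF : ∀ q y, (γ q)⁻¹ • y ∈ F (rep q) ↔ y ∈ F q := fun q y => by
    rw [← hF' (γ q), smul_inv_smul, hγ]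
  let H : Q → ℝ → Y → Y := fun q s y =>
    if y ∈ F q then γ q • H₀ (rep q) s ((γ q)⁻¹ • y) else y
  have hH : ∀ {q s y}, y ∈ F q → H q s y = γ q • H₀ (rep q) s ((γ q)⁻¹ • y) := fun h => if_pos h
  refine ⟨H, hne, fun q s y hy => ?_, fun q s y hy => if_neg hy, fun q y => ?_,
    fun q y hy y' hy' => ?_, fun q => ?_, fun g q s y => ?_⟩
  · rw [hH hy, ← hγF, inv_smul_smul]
    exact hmaps _ _ ((hγF q y).2 hy)
  · by_cases hy : y ∈ F q
    · rw [hH hy, h0 _ _ ((hγF q y).2 hy), smul_inv_smul]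
    · exact if_neg hy
  · rw [hH hy, hH hy', h1 _ _ ((hγF q y).2 hy) _ ((hγF q y').2 hy')]
  · have hc : ContinuousOn (fun x : ℝ × Y => γ q • Function.uncurry (H₀ (rep q))
        (x.1, (γ q)⁻¹ • x.2)) (Set.univ ×ˢ F q) := by
      refine ContinuousOn.const_smul (((hcont (rep q)).comp ?_ ?_)) _
      · exact (continuous_fst.prodMk (continuous_snd.const_smul _)).continuousOn
      · exact fun x hx => ⟨trivial, (hγF q _).2 hx.2⟩
    exact hc.congr fun x hx => hH hx.2
  · by_cases hy : y ∈ F q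
    · rw [hH hy, hH ((hF' g q y).2 hy), hrep]
      -- The two ways of transporting from the representative to `g • q` differ by an element of its
      -- stabiliser, for which `H₀` is already equivariant.
      have hk : ((γ (g • q))⁻¹ * g * γ q) • rep q = rep q := by
        rw [mul_smul, mul_smul, hγ, inv_smul_eq_iff]
        conv_rhs => rw [← hrep g, hγ]
      have := hsmul (rep q) _ hk s _ ((hγF q y).2 hy)
      rw [smul_smul, mul_inv_cancel_right, mul_smul] at this
      rw [this, smul_smul, smul_smul]
      congr 1
      group
    · rw [show H q s y = y from if_neg hy]
      exact if_neg fun h => hy ((hF' g q y).1 h)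

end Contraction

/-! ### Finite chains as increasing lists. -/

section ChainList

variable {Q : Type*} [PartialOrder Q]

theorem exists_sorted_list {c : Finset Q} (hc : IsChain (· ≤ ·) (c : Set Q)) :
    ∃ l : List Q, l.Pairwise (· < ·) ∧ ∀ x, x ∈ l ↔ x ∈ c := by
  classical
  induction h : c.card generalizing c with
  | zero =>
    obtain rfl := Finset.card_eq_zero.1 h
    exact ⟨[], List.Pairwise.nil, by simp⟩
  | succ n ih =>
    obtain ⟨m, hm⟩ := c.exists_minimal (Finset.card_pos.1 (by omega))
    have hle : ∀ x ∈ c, m ≤ x := fun x hx =>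
      (hc.total hm.prop hx).elim id fun h' => hm.le_of_le hx h'
    obtain ⟨l, hl, hlc⟩ := ih (c := c.erase m) (hc.mono (by simp))
      (by rw [Finset.card_erase_of_mem hm.prop, h]; rfl)
    refine ⟨m :: l, List.pairwise_cons.2 ⟨fun x hx => ?_, hl⟩, fun x => ?_⟩
    · have := Finset.mem_erase.1 ((hlc x).1 hx)
      exact lt_of_le_of_ne (hle x this.2) this.1.symm
    · rw [List.mem_cons, hlc, Finset.mem_erase]
      by_cases hx : x = m
      · simp [hx, hm.prop]
      · simp [hx]

open Classical in
/-- The elements of a finite chain in increasing order. -/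
noncomputable def chainList (c : Finset Q) : List Q :=
  if h : ∃ l : List Q, l.Pairwise (· < ·) ∧ ∀ x, x ∈ l ↔ x ∈ c then h.choose else []

theorem pairwise_chainList {c : Finset Q} (hc : IsChain (· ≤ ·) (c : Set Q)) :
    (chainList c).Pairwise (· < ·) := by
  have h := exists_sorted_list hc
  rw [chainList, dif_pos h]
  exact h.choose_spec.1

theorem mem_chainList {c : Finset Q} (hc : IsChain (· ≤ ·) (c : Set Q)) {x : Q} :
    x ∈ chainList c ↔ x ∈ c := by
  have h := exists_sorted_list hc
  rw [chainList, dif_pos h]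
  exact h.choose_spec.2 x

theorem eq_chainList {c : Finset Q} (hc : IsChain (· ≤ ·) (c : Set Q)) {l : List Q}
    (hl : l.Pairwise (· < ·)) (hlc : ∀ x, x ∈ l ↔ x ∈ c) : l = chainList c := by
  have hl' := pairwise_chainList hc
  refine List.Perm.eq_of_pairwise (le := (· < ·)) (fun a b _ _ h h' => (lt_asymm h h').elim)
    hl hl' ((List.perm_ext_iff_of_nodup ?_ ?_).2 fun x => by rw [hlc, mem_chainList hc])
  · exact hl.imp fun h => h.ne
  · exact hl'.imp fun h => h.ne

end ChainList

/-! ### Successive contractions along a chain. -/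

/-- Applying the maps `H q (s q)` successively for the elements `q` of a list. -/
def foldContractions {Q Y : Type*} (H : Q → ℝ → Y → Y) (l : List Q) (s : Q → ℝ) (y : Y) : Y :=
  l.foldl (fun y q => H q (s q) y) y

namespace IsEquivariantContraction

variable {G Q Y : Type*} [Group G] [MulAction G Q] [TopologicalSpace Y] [MulAction G Y]
  {F : Q → Set Y} {H : Q → ℝ → Y → Y}

theorem fold_zero (hH : IsEquivariantContraction G F H) (l : List Q) {s : Q → ℝ}
    (hs : ∀ q ∈ l, s q = 0) (y : Y) : foldContractions H l s y = y := by
  induction l with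
  | nil => rfl
  | cons q l ih =>
    rw [foldContractions, List.foldl_cons, hs q List.mem_cons_self, hH.zero]
    exact ih fun q hq => hs q (List.mem_cons_of_mem _ hq)

/-- Contractions run for time `0` are identities. Hence a formula over the varying support of a
point can be rewritten over a fixed simplex, where continuity is checked. -/
theorem fold_filter (hH : IsEquivariantContraction G F H) (l : List Q) {s : Q → ℝ}
    (P : Q → Prop) [DecidablePred P] (hs : ∀ q, s q ≠ 0 → P q) (y : Y) :
    foldContractions H (l.filter P) s y = foldContractions H l s y := by
  induction l generalizing y with
  | nil => rfl
  | cons q l ih =>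
    by_cases hq : P q
    · rw [List.filter_cons_of_pos (by simpa using hq)]
      exact ih _
    · rw [List.filter_cons_of_neg (by simpa using hq), ih]
      simp only [foldContractions, List.foldl_cons]
      rw [not_not.1 fun h => hq (hs q h), hH.zero]

theorem fold_smul (hH : IsEquivariantContraction G F H) (g : G) (l : List Q) {s s' : Q → ℝ}
    (hs : ∀ q, s' (g • q) = s q) (y : Y) :
    foldContractions H (l.map (g • ·)) s' (g • y) = g • foldContractions H l s y := by
  induction l generalizing y with
  | nil => rfl
  | cons q l ih =>
    simp only [foldContractions, List.map_cons, List.foldl_cons] at ih ⊢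
    rw [hs, hH.smul, ih]

/-- `H q` is continuous only over `F q`, but it is the identity at time `0`. The closed sets `{s =
0}` and `{y ∈ F q}` cover `T`, and the two formulas are glued along them. -/
theorem continuous_apply (hH : IsEquivariantContraction G F H) (hcl : ∀ q, IsClosed (F q))
    {T : Type*} [TopologicalSpace T] (q : Q) {s : T → ℝ} (hs : Continuous s) {y : T → Y}
    (hy : Continuous y) (hsy : ∀ t, s t ≠ 0 → y t ∈ F q) : Continuous fun t => H q (s t) (y t) := by
  have hA : IsClosed {t | s t = 0} := isClosed_eq hs continuous_const
  have hB : IsClosed {t | y t ∈ F q} := (hcl q).preimage hy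
  rw [← continuousOn_univ]
  have hAB : {t | s t = 0} ∪ {t | y t ∈ F q} = Set.univ :=
    Set.eq_univ_of_forall fun t => or_iff_not_imp_left.2 (hsy t)
  rw [← hAB]
  refine ContinuousOn.union_of_isClosed ?_ ?_ hA hB
  · refine hy.continuousOn.congr fun t ht => ?_
    rw [show s t = 0 from ht, hH.zero]
  · exact (hH.continuousOn q).comp (hs.prodMk hy).continuousOn fun t ht => ⟨trivial, ht⟩

variable [PartialOrder Q]

/-- A point of `F q` stays in `F q ⊆ F q'`, and any other point is fixed. This is why contractions
are applied in increasing order: earlier ones cannot leave later carriers. -/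
theorem mem_of_le (hH : IsEquivariantContraction G F H) (hF : Monotone F) {q q' : Q}
    (hq : q ≤ q') (s : ℝ) {y : Y} (hy : y ∈ F q') : H q s y ∈ F q' := by
  by_cases hyq : y ∈ F q
  · exact hF hq (hH.mapsTo q s hyq)
  · rwa [hH.apply_of_notMem q s y hyq]

theorem fold_mem (hH : IsEquivariantContraction G F H) (hF : Monotone F) {q' : Q} {l : List Q}
    (hl : ∀ q ∈ l, q ≤ q') (s : Q → ℝ) {y : Y} (hy : y ∈ F q') :
    foldContractions H l s y ∈ F q' := by
  induction l generalizing y with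
  | nil => exact hy
  | cons q l ih =>
    exact ih (fun q hq => hl q (List.mem_cons_of_mem _ hq))
      (hH.mem_of_le hF (hl q List.mem_cons_self) _ hy)

/-- If some parameter equals `1`, the result does not depend on the starting point. -/
theorem fold_eq_fold (hH : IsEquivariantContraction G F H) (hF : Monotone F) {l : List Q}
    (hl : l.Pairwise (· < ·)) {s : Q → ℝ} {y y' : Y} (hy : ∀ q ∈ l, s q ≠ 0 → y ∈ F q)
    (hy' : ∀ q ∈ l, s q ≠ 0 → y' ∈ F q) (h1 : ∃ q ∈ l, s q = 1) :
    foldContractions H l s y = foldContractions H l s y' := by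
  induction l generalizing y y' with
  | nil => simp at h1
  | cons q l ih =>
    rw [List.pairwise_cons] at hl
    simp only [foldContractions, List.foldl_cons] at ih ⊢
    -- A complete contraction merges the two points, which then stay equal. Any other step keeps
    -- both in the carriers still to come.
    by_cases hq : s q = 1
    · rw [hq, hH.one q y (hy q List.mem_cons_self (by simp [hq])) y'
        (hy' q List.mem_cons_self (by simp [hq]))]
    · refine ih hl.2 (fun r hr hsr => ?_) (fun r hr hsr => ?_) ?_
      · exact hH.mem_of_le hF (hl.1 r hr).le _ (hy r (List.mem_cons_of_mem _ hr) hsr)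
      · exact hH.mem_of_le hF (hl.1 r hr).le _ (hy' r (List.mem_cons_of_mem _ hr) hsr)
      · obtain ⟨r, hr, hsr⟩ := h1
        rcases List.mem_cons.1 hr with rfl | hr
        · exact (hq hsr).elim
        · exact ⟨r, hr, hsr⟩

theorem continuous_fold (hH : IsEquivariantContraction G F H) (hF : Monotone F)
    (hcl : ∀ q, IsClosed (F q)) {T : Type*} [TopologicalSpace T] {l : List Q}
    (hl : l.Pairwise (· < ·)) {s : T → Q → ℝ} (hs : ∀ q ∈ l, Continuous fun t => s t q)
    {y : T → Y} (hy : Continuous y) (hsy : ∀ q ∈ l, ∀ t, s t q ≠ 0 → y t ∈ F q) :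
    Continuous fun t => foldContractions H l (s t) (y t) := by
  induction l generalizing y with
  | nil => exact hy
  | cons q l ih =>
    rw [List.pairwise_cons] at hl
    refine ih hl.2 (fun r hr => hs r (List.mem_cons_of_mem _ hr))
      (hH.continuous_apply hcl q (hs q List.mem_cons_self) hy (hsy q List.mem_cons_self)) ?_
    exact fun r hr t ht => hH.mem_of_le hF (hl.1 r hr).le _ (hsy r (List.mem_cons_of_mem _ hr) t ht)

end IsEquivariantContraction

namespace Realization

open PreAbstractSimplicialComplex

/-! ### Contraction times from relative barycentric coordinates. -/

section RelCoord

open scoped NNReal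

variable {ι : Type*} {K : PreAbstractSimplicialComplex ι}

/-- The barycentric coordinates as nonnegative real numbers. -/
def nncoord (p : Realization K) (v : ι) : ℝ≥0 := ⟨p.coord v, p.nonneg v⟩

theorem nncoord_pos {p : Realization K} {v : ι} : 0 < p.nncoord v ↔ v ∈ p.coord.support :=
  ⟨fun h => p.mem_support_of_pos h, fun h => p.coord_pos h⟩

theorem nncoord_eq_zero {p : Realization K} {v : ι} (hv : v ∉ p.coord.support) :
    p.nncoord v = 0 :=
  Subtype.ext (Finsupp.notMem_support_iff.1 hv)

theorem continuous_nncoord (v : ι) : Continuous fun p : Realization K => p.nncoord v :=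
  (continuous_coord v).subtype_mk _

/-- The largest barycentric coordinate of a point. -/
noncomputable def maxCoord (p : Realization K) : ℝ≥0 := p.coord.support.sup p.nncoord

theorem maxCoord_eq_sup (p : Realization K) {s : Finset ι} (hs : p.coord.support ⊆ s) :
    p.maxCoord = s.sup p.nncoord := by
  refine le_antisymm (Finset.sup_mono hs) (Finset.sup_le fun v _ => ?_)
  by_cases hv : v ∈ p.coord.support
  · exact Finset.le_sup hv
  · rw [nncoord_eq_zero hv]
    exact zero_le

theorem exists_eq_maxCoord (p : Realization K) : ∃ v ∈ p.coord.support, p.nncoord v = p.maxCoord :=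
  let ⟨v, hv, h⟩ := Finset.exists_mem_eq_sup _ p.support_nonempty p.nncoord
  ⟨v, hv, h.symm⟩

theorem maxCoord_pos (p : Realization K) : 0 < p.maxCoord := by
  obtain ⟨v, hv, h⟩ := p.exists_eq_maxCoord
  rw [← h]
  exact nncoord_pos.2 hv

theorem continuous_maxCoord : Continuous (maxCoord : Realization K → ℝ≥0) := by
  refine continuous_iff.2 fun s hs => ?_
  have : (fun p : ClosedSimplex K s => maxCoord p.1) = fun p => s.sup fun v => p.1.nncoord v :=
    funext fun p => p.1.maxCoord_eq_sup p.2
  rw [this]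
  exact Continuous.finset_sup_apply fun v _ =>
    (continuous_nncoord v).comp (continuous_closedSimplex_val hs)

/-- The barycentric coordinates divided by the largest one. -/
noncomputable def relCoord (p : Realization K) (v : ι) : ℝ := p.coord v / p.maxCoord

theorem relCoord_eq_zero {p : Realization K} {v : ι} (hv : v ∉ p.coord.support) :
    p.relCoord v = 0 := by
  rw [relCoord, Finsupp.notMem_support_iff.1 hv, zero_div]

theorem exists_relCoord_eq_one (p : Realization K) : ∃ v ∈ p.coord.support, p.relCoord v = 1 := by
  obtain ⟨v, hv, h⟩ := p.exists_eq_maxCoord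
  refine ⟨v, hv, ?_⟩
  rw [relCoord, ← h]
  exact div_self (p.coord_pos hv).ne'

theorem continuous_relCoord (v : ι) : Continuous fun p : Realization K => p.relCoord v :=
  (continuous_coord v).div (NNReal.continuous_coe.comp continuous_maxCoord)
    fun p => (NNReal.coe_pos.2 p.maxCoord_pos).ne'

variable {G : Type*} [Group G] [MulAction G ι] [IsSimplicialAction G K]

theorem nncoord_smul_smul (g : G) (p : Realization K) (v : ι) :
    (g • p).nncoord (g • v) = p.nncoord v :=
  Subtype.ext (smul_coord_smul g p v)

theorem maxCoord_smul (g : G) (p : Realization K) : (g • p).maxCoord = p.maxCoord := by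
  rw [maxCoord, support_smul, Finset.sup_map, maxCoord]
  exact Finset.sup_congr rfl fun v _ => nncoord_smul_smul g p v

theorem relCoord_smul_smul (g : G) (p : Realization K) (v : ι) :
    (g • p).relCoord (g • v) = p.relCoord v := by
  rw [relCoord, relCoord, smul_coord_smul, maxCoord_smul]

/-- A parameter that is positive only at coordinates larger than half of the largest one. -/
noncomputable def resetParam (p : Realization K) (v : ι) : ℝ := max 0 (2 * p.relCoord v - 1)

theorem mem_support_of_resetParam {p : Realization K} {v : ι} (h : p.resetParam v ≠ 0) :
    v ∈ p.coord.support := by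
  by_contra hv
  simp [resetParam, relCoord_eq_zero hv] at h

theorem exists_resetParam_eq_one (p : Realization K) :
    ∃ v ∈ p.coord.support, p.resetParam v = 1 := by
  obtain ⟨v, hv, h⟩ := p.exists_relCoord_eq_one
  exact ⟨v, hv, by norm_num [resetParam, h]⟩

theorem continuous_resetParam (v : ι) : Continuous fun p : Realization K => p.resetParam v :=
  continuous_const.max ((continuous_const.mul (continuous_relCoord v)).sub continuous_const)

theorem resetParam_smul_smul (g : G) (p : Realization K) (v : ι) :
    (g • p).resetParam (g • v) = p.resetParam v := by
  rw [resetParam, relCoord_smul_smul, resetParam]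

end RelCoord

/-! ### Truncation, and maps carried by contractible subspaces. -/

section OrderComplex

variable {Q : Type*} [PartialOrder Q]

theorem isChain_support (p : Realization (orderComplex Q)) :
    IsChain (· ≤ ·) (p.coord.support : Set Q) :=
  p.support_mem.2

theorem exists_isLeast_support (p : Realization (orderComplex Q)) :
    ∃ m ∈ p.coord.support, ∀ q ∈ p.coord.support, m ≤ q := by
  obtain ⟨m, hm⟩ := p.coord.support.exists_minimal p.support_nonempty
  exact ⟨m, hm.prop, fun q hq => (p.isChain_support.total hm.prop hq).elim id (hm.le_of_le hq)⟩

open Classical in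
/-- Weights that vanish at all vertices above a vertex whose coordinate is at least half of the
largest one. -/
noncomputable def truncateWeight (p : Realization (orderComplex Q)) (k : Q) : ℝ :=
  p.coord k * ∏ j ∈ p.coord.support with j < k, max 0 (1 - 2 * p.relCoord j)

theorem mem_support_of_truncateWeight {p : Realization (orderComplex Q)} {k : Q}
    (h : p.truncateWeight k ≠ 0) : k ∈ p.coord.support :=
  Finsupp.mem_support_iff.2 (left_ne_zero_of_mul h)

/-- The least vertex of the support has an empty product of cut-off factors, so its weight survives.
-/
theorem isWeight_truncateWeight (p : Realization (orderComplex Q)) :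
    IsWeight (orderComplex Q) p.truncateWeight := by
  classical
  refine ⟨fun v => mul_nonneg (p.nonneg v) (Finset.prod_nonneg fun _ _ => le_max_left _ _), ?_,
    _, p.support_mem, fun _ => mem_support_of_truncateWeight⟩
  obtain ⟨m, hm, hle⟩ := p.exists_isLeast_support
  refine ⟨m, ?_⟩
  rw [truncateWeight, Finset.filter_false_of_mem fun j hj hlt => (hle j hj).not_gt hlt,
    Finset.prod_empty, mul_one]
  exact (p.coord_pos hm).ne'

/-- The thresholds meet at one half: `k` survives only if every support vertex strictly below it has
relative coordinate below `1/2`, while `j` is reset only if its own exceeds `1/2`. Since the support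
is a chain, `j < k` is impossible. -/
theorem le_of_truncateWeight_of_resetParam {p : Realization (orderComplex Q)} {k j : Q}
    (hk : p.truncateWeight k ≠ 0) (hj : p.resetParam j ≠ 0) : k ≤ j := by
  classical
  have hjs := mem_support_of_resetParam hj
  by_contra hkj
  have hjk : j < k := lt_of_le_not_ge
    ((p.isChain_support.total (mem_support_of_truncateWeight hk) hjs).resolve_left hkj) hkj
  have h0 := Finset.prod_ne_zero_iff.1 (right_ne_zero_of_mul hk) j
    (Finset.mem_filter.2 ⟨hjs, hjk⟩)
  rw [resetParam] at hj
  rcases le_total (2 * p.relCoord j) 1 with h | h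
  · exact hj (max_eq_left (by linarith))
  · exact h0 (max_eq_left (by linarith))

/-- The self-map of the realisation of a poset given by `truncateWeight`. -/
noncomputable def truncate : C(Realization (orderComplex Q), Realization (orderComplex Q)) where
  toFun p := ofWeights _ p.isWeight_truncateWeight
  continuous_toFun := by
    classical
    refine continuous_iff.2 fun s hs => ?_
    refine continuous_ofWeights _ s (fun p v hv => p.2 (mem_support_of_truncateWeight hv))
      fun k => ?_
    have : (fun p : ClosedSimplex (orderComplex Q) s => p.1.truncateWeight k) = fun p =>
        p.1.coord k * ∏ j ∈ s with j < k, max 0 (1 - 2 * p.1.relCoord j) := by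
      funext p
      rw [truncateWeight]
      congr 1
      refine Finset.prod_subset (Finset.filter_subset_filter _ p.2) fun j hj hjp => ?_
      have : j ∉ p.1.coord.support := fun h =>
        hjp (Finset.mem_filter.2 ⟨h, (Finset.mem_filter.1 hj).2⟩)
      rw [relCoord_eq_zero this]
      norm_num
    rw [this]
    refine (continuous_closedSimplex_coord s k).mul (continuous_finsetProd _ fun j _ => ?_)
    exact continuous_const.max (continuous_const.sub (continuous_const.mul
      ((continuous_relCoord j).comp (continuous_closedSimplex_val hs))))

theorem mem_support_truncate {p : Realization (orderComplex Q)} {k : Q} :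
    k ∈ (truncate p).coord.support ↔ p.truncateWeight k ≠ 0 :=
  mem_support_ofWeights p.isWeight_truncateWeight

theorem support_truncate_subset (p : Realization (orderComplex Q)) :
    (truncate p).coord.support ⊆ p.coord.support := fun _ hk =>
  mem_support_of_truncateWeight (mem_support_truncate.1 hk)

theorem chainList_support_eq_filter [DecidableEq Q] {s : Finset Q} (hs : s ∈ orderComplex Q)
    {p : Realization (orderComplex Q)} (hp : p.coord.support ⊆ s) :
    chainList p.coord.support = (chainList s).filter (· ∈ p.coord.support) := by
  refine (eq_chainList p.isChain_support ((pairwise_chainList hs.2).filter _) fun x => ?_).symm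
  rw [List.mem_filter, mem_chainList hs.2, decide_eq_true_iff]
  exact ⟨fun h => h.2, fun h => ⟨hp h, h⟩⟩

theorem fold_chainList_support {G Y : Type*} [Group G] [MulAction G Q] [TopologicalSpace Y]
    [MulAction G Y] {F : Q → Set Y} {H : Q → ℝ → Y → Y} (hH : IsEquivariantContraction G F H) {s : Finset Q}
    (hs : s ∈ orderComplex Q) {p : Realization (orderComplex Q)} (hp : p.coord.support ⊆ s)
    (t : ℝ) (y : Y) :
    foldContractions H (chainList p.coord.support) (fun q => t * p.resetParam q) y =
      foldContractions H (chainList s) (fun q => t * p.resetParam q) y := by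
  classical
  rw [chainList_support_eq_filter hs hp]
  exact hH.fold_filter _ (· ∈ p.coord.support)
    (fun q hq => mem_support_of_resetParam (right_ne_zero_of_mul hq)) y

variable {G : Type*} [Group G] [MulAction G Q] [CovariantClass G Q HSMul.hSMul LE.le]

theorem smul_lt_smul_iff_of_covariant (g : G) {x y : Q} : g • x < g • y ↔ x < y := by
  have h : ∀ (g : G) {x y : Q}, x ≤ y → g • x ≤ g • y := fun g _ _ h => smul_mono_right g h
  have h' : ∀ {x y : Q}, g • x ≤ g • y ↔ x ≤ y := fun {x y} =>
    ⟨fun hxy => by simpa using h g⁻¹ hxy, h g⟩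
  rw [lt_iff_le_not_ge, lt_iff_le_not_ge, h', h']

theorem truncate_smul (g : G) (p : Realization (orderComplex Q)) :
    truncate (g • p) = g • truncate p := by
  classical
  refine (smul_ofWeights g p.isWeight_truncateWeight (g • p).isWeight_truncateWeight
    fun k => ?_).symm
  rw [truncateWeight, truncateWeight, smul_coord_smul, support_smul, Finset.filter_map,
    Finset.prod_map]
  congr 1
  refine Finset.prod_congr ?_ fun j _ => ?_
  · ext j
    simp [smul_lt_smul_iff_of_covariant]
  · simp only [Equiv.coe_toEmbedding, MulAction.toPerm_apply, relCoord_smul_smul]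

theorem gHomotopic_id_truncate :
    GHomotopic G (ContinuousMap.id (Realization (orderComplex Q))) truncate :=
  gHomotopic_id _ truncate_smul
    (fun p => ⟨_, p.support_mem, Finset.Subset.refl _, p.support_truncate_subset⟩)
    fun s _ => ⟨s, fun p hp => p.support_truncate_subset.trans hp⟩

theorem chainList_support_smul (g : G) (p : Realization (orderComplex Q)) :
    chainList (g • p).coord.support = (chainList p.coord.support).map (g • ·) := by
  refine (eq_chainList (g • p).isChain_support ?_ fun x => ?_).symm
  · rw [List.pairwise_map]
    exact (pairwise_chainList p.isChain_support).imp (smul_lt_smul_iff_of_covariant g).2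
  · rw [mem_support_smul, List.mem_map]
    constructor
    · rintro ⟨y, hy, rfl⟩
      rw [inv_smul_smul]
      exact (mem_chainList p.isChain_support).1 hy
    · exact fun h => ⟨_, (mem_chainList p.isChain_support).2 h, smul_inv_smul g x⟩

variable {Y : Type*} [TopologicalSpace Y] [MulAction G Y]
  {F : Q → Set Y} {H : Q → ℝ → Y → Y}

/-- An order complex maps equivariantly to any space along a monotone equivariant family of closed
equivariantly contractible subspaces. -/
theorem exists_carried_map (hF : Monotone F) (hcl : ∀ q, IsClosed (F q))
    (hH : IsEquivariantContraction G F H) (hFG : ∀ (g : G) q, ∀ y ∈ F q, g • y ∈ F (g • q)) :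
    ∃ h : C(Realization (orderComplex Q), Y), (∀ (g : G) p, h (g • p) = g • h p) ∧
      ∀ p q, (∀ r ∈ p.coord.support, r ≤ q) → h p ∈ F q := by
  have hbase : ∀ p : Realization (orderComplex Q), ∃ y, ∀ q ∈ p.coord.support, y ∈ F q := by
    intro p
    obtain ⟨m, _, hm⟩ := p.exists_isLeast_support
    obtain ⟨y, hy⟩ := hH.nonempty m
    exact ⟨y, fun q hq => hF (hm q hq) hy⟩
  choose b hb using hbase
  let h : Realization (orderComplex Q) → Y := fun p =>
    foldContractions H (chainList p.coord.support) (fun q => 1 * p.resetParam q) (b p)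
  -- The choice `b` is neither continuous nor equivariant, but some parameter is `1`, so any
  -- admissible starting point gives the same value: a constant one over a simplex for continuity,
  -- `g • b p` for equivariance.
  have hh : ∀ p y, (∀ q ∈ p.coord.support, y ∈ F q) → h p =
      foldContractions H (chainList p.coord.support) (fun q => 1 * p.resetParam q) y := by
    intro p y hy
    refine hH.fold_eq_fold hF (pairwise_chainList p.isChain_support)
      (fun q hq _ => hb p q ((mem_chainList p.isChain_support).1 hq))
      (fun q hq _ => hy q ((mem_chainList p.isChain_support).1 hq)) ?_
    obtain ⟨q, hq, h1⟩ := p.exists_resetParam_eq_one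
    exact ⟨q, (mem_chainList p.isChain_support).2 hq, by rw [h1, mul_one]⟩
  refine ⟨⟨h, continuous_iff.2 fun s hs => ?_⟩, fun g p => ?_, fun p q hq => ?_⟩
  · obtain ⟨m, hm⟩ := s.exists_minimal hs.1
    obtain ⟨y, hy⟩ := hH.nonempty m
    have hys : ∀ q ∈ s, y ∈ F q := fun q hq =>
      hF ((hs.2.total hm.prop hq).elim id (hm.le_of_le hq)) hy
    have : (fun p : ClosedSimplex (orderComplex Q) s => h p.1) = fun p =>
        foldContractions H (chainList s) (fun q => 1 * p.1.resetParam q) y :=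
      funext fun p => by
        rw [hh p.1 y fun q hq => hys q (p.2 hq), fold_chainList_support hH hs p.2]
    rw [this]
    refine hH.continuous_fold hF hcl (pairwise_chainList hs.2) (fun q _ => ?_) continuous_const
      fun q hq _ _ => hys q ((mem_chainList hs.2).1 hq)
    exact continuous_const.mul
      ((continuous_resetParam q).comp (continuous_closedSimplex_val hs))
  · change h (g • p) = g • h p
    rw [hh (g • p) (g • b p), chainList_support_smul, hH.fold_smul g]
    · exact fun q => by rw [resetParam_smul_smul]
    · intro q hq
      rw [mem_support_smul] at hq
      simpa using hFG g _ _ (hb p _ hq)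
  · obtain ⟨m, hm, _⟩ := p.exists_isLeast_support
    refine hH.fold_mem hF (fun r hr => hq r ((mem_chainList p.isChain_support).1 hr)) _ ?_
    exact hF (hq m hm) (hb p m hm)

/-- Two equivariant maps carried by a monotone family of closed equivariantly contractible
subspaces are equivariantly homotopic. -/
theorem gHomotopic_of_carried (hF : Monotone F) (hcl : ∀ q, IsClosed (F q))
    (hH : IsEquivariantContraction G F H) {f₀ f₁ : C(Realization (orderComplex Q), Y)}
    (hf₀ : ∀ (g : G) p, f₀ (g • p) = g • f₀ p) (hf₁ : ∀ (g : G) p, f₁ (g • p) = g • f₁ p)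
    (h₀ : ∀ p q, (∀ r ∈ p.coord.support, r ≤ q) → f₀ p ∈ F q)
    (h₁ : ∀ p q, (∀ r ∈ p.coord.support, r ≤ q) → f₁ p ∈ F q) : GHomotopic G f₀ f₁ := by
  -- Truncation pushes the support below every vertex with nonzero parameter, so the contractions
  -- apply to `f (truncate p)` within their carriers.
  have hvalid : ∀ f : C(Realization (orderComplex Q), Y),
      (∀ p q, (∀ r ∈ p.coord.support, r ≤ q) → f p ∈ F q) →
      ∀ p q, p.resetParam q ≠ 0 → f (truncate p) ∈ F q := fun f hf p q hq =>
    hf _ q fun r hr => le_of_truncateWeight_of_resetParam (mem_support_truncate.1 hr) hq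
  -- `f` is deformed to `f ∘ truncate` by a straight line in the source, and then the contractions
  -- are run with all times scaled from `0` to `1`.
  have key : ∀ f : C(Realization (orderComplex Q), Y),
      (∀ (g : G) p, f (g • p) = g • f p) →
      (∀ p q, (∀ r ∈ p.coord.support, r ≤ q) → f p ∈ F q) →
      ∃ e : C(Realization (orderComplex Q), Y), GHomotopic G f e ∧ ∀ p, e p =
        foldContractions H (chainList p.coord.support) (fun q => 1 * p.resetParam q)
          (f (truncate p)) := by
    intro f hfG hf
    let D : unitInterval × Realization (orderComplex Q) → Y := fun x =>
      foldContractions H (chainList x.2.coord.support) (fun q => x.1 * x.2.resetParam q)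
        (f (truncate x.2))
    have hD : Continuous D := by
      refine continuous_homotopy fun s hs => ?_
      have : (fun x : unitInterval × ClosedSimplex (orderComplex Q) s => D (x.1, x.2.1)) =
          fun x => foldContractions H (chainList s) (fun q => x.1 * x.2.1.resetParam q)
            (f (truncate x.2.1)) :=
        funext fun x => fold_chainList_support hH hs x.2.2 _ _
      rw [this]
      have hval : Continuous fun x : unitInterval × ClosedSimplex (orderComplex Q) s => x.2.1 :=
        (continuous_closedSimplex_val hs).comp continuous_snd
      refine hH.continuous_fold hF hcl (pairwise_chainList hs.2) (fun q _ => ?_)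
        (f.continuous.comp (truncate.continuous.comp hval))
        fun q _ x hx => hvalid f hf _ q (right_ne_zero_of_mul hx)
      exact (continuous_subtype_val.comp continuous_fst).mul ((continuous_resetParam q).comp hval)
    let e : C(Realization (orderComplex Q), Y) :=
      ⟨fun p => D (1, p), hD.comp (Continuous.prodMk_right 1)⟩
    have he : GHomotopic G (f.comp truncate) e := by
      refine ⟨⟨⟨D, hD⟩, fun p => ?_, fun p => rfl⟩, fun g t p => ?_⟩
      · exact hH.fold_zero _ (fun q _ => by simp) _
      · change D (t, g • p) = g • D (t, p)
        simp only [D]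
        rw [truncate_smul, hfG, chainList_support_smul, hH.fold_smul g]
        exact fun q => by rw [resetParam_smul_smul]
    refine ⟨e, GHomotopic.trans (gHomotopic_id_truncate.comp_left f hfG) he, fun p => ?_⟩
    simp [e, D]
  obtain ⟨e₀, he₀, h0⟩ := key f₀ hf₀ h₀
  obtain ⟨e₁, he₁, h1⟩ := key f₁ hf₁ h₁
  -- At the end of the deformation one contraction is complete, so the result no longer depends on
  -- the map it started from.
  have : e₀ = e₁ := by
    ext p
    rw [h0, h1]
    refine hH.fold_eq_fold hF (pairwise_chainList p.isChain_support)
      (fun q _ hq => hvalid f₀ h₀ p q (right_ne_zero_of_mul hq))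
      (fun q _ hq => hvalid f₁ h₁ p q (right_ne_zero_of_mul hq)) ?_
    obtain ⟨q, hq, h1⟩ := p.exists_resetParam_eq_one
    exact ⟨q, (mem_chainList p.isChain_support).2 hq, by rw [h1, mul_one]⟩
  subst this
  exact he₀.trans he₁.symm

end OrderComplex

end Realization

/-! ### The face poset. -/

/-- The simplices of a simplicial complex, ordered by reverse inclusion. -/
def FacePoset {ι : Type*} (K : PreAbstractSimplicialComplex ι) : Type _ := {s : Finset ι // s ∈ K}

namespace FacePoset

open PreAbstractSimplicialComplex

variable {ι : Type*} {K : PreAbstractSimplicialComplex ι}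

instance : PartialOrder (FacePoset K) where
  -- Larger simplices are smaller elements, which makes intersections of cover members and closed
  -- stars monotone in the simplex.
  le s t := t.1 ⊆ s.1
  le_refl s := Finset.Subset.refl s.1
  le_trans _ _ _ h h' := Finset.Subset.trans h' h
  le_antisymm _ _ h h' := Subtype.ext (Finset.Subset.antisymm h' h)

theorem nonempty (s : FacePoset K) : s.1.Nonempty := nonempty_of_mem s.2

variable {G : Type*} [Group G] [MulAction G ι] [IsSimplicialAction G K]

instance : MulAction G (FacePoset K) where
  smul g s := ⟨s.1.map (MulAction.toPerm g).toEmbedding, IsSimplicialAction.map_mem g _ s.2⟩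
  one_smul s := Subtype.ext (by
    ext v
    change v ∈ s.1.map _ ↔ _
    simp)
  mul_smul g h s := Subtype.ext (by
    ext v
    change v ∈ s.1.map _ ↔ v ∈ (s.1.map _).map _
    simp [mul_smul])

theorem smul_val (g : G) (s : FacePoset K) :
    (g • s).1 = s.1.map (MulAction.toPerm g).toEmbedding := rfl

theorem smul_mem_smul {g : G} {s : FacePoset K} {v : ι} : g • v ∈ (g • s).1 ↔ v ∈ s.1 :=
  Finset.mem_map' (MulAction.toPerm g).toEmbedding (a := v)

theorem mem_smul {g : G} {s : FacePoset K} {v : ι} : v ∈ (g • s).1 ↔ g⁻¹ • v ∈ s.1 := by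
  rw [← smul_mem_smul (g := g) (v := g⁻¹ • v), smul_inv_smul]

instance : CovariantClass G (FacePoset K) HSMul.hSMul LE.le where
  elim _ _ _ h := Finset.map_subset_map.2 h

end FacePoset

namespace Realization

open PreAbstractSimplicialComplex

/-! ### Maps induced by monotone assignments of simplices. -/

section UnionMap

variable {Q ι : Type*} [PartialOrder Q] {K : PreAbstractSimplicialComplex ι} {A : Q → FacePoset K}

open Classical in
/-- The weights obtained by giving the mass of every vertex `q` to all elements of `A q`. -/
noncomputable def unionWeight (A : Q → FacePoset K) (p : Realization (orderComplex Q)) (v : ι) :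
    ℝ :=
  ∑ q ∈ p.coord.support with v ∈ (A q).1, p.coord q

theorem unionWeight_ne_zero {p : Realization (orderComplex Q)} {v : ι} :
    unionWeight A p v ≠ 0 ↔ ∃ q ∈ p.coord.support, v ∈ (A q).1 := by
  classical
  rw [unionWeight, Ne, Finset.sum_eq_zero_iff_of_nonneg fun q _ => p.nonneg q]
  push Not
  simp only [Finset.mem_filter]
  exact ⟨fun ⟨q, h, _⟩ => ⟨q, h⟩, fun ⟨q, h⟩ => ⟨q, h, (p.coord_pos h.1).ne'⟩⟩

/-- By monotonicity the simplex attached to the least vertex of the support contains all the others,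
so it carries every weight. -/
theorem isWeight_unionWeight (hA : Monotone A) (p : Realization (orderComplex Q)) :
    IsWeight K (unionWeight A p) := by
  classical
  obtain ⟨m, hm, hle⟩ := p.exists_isLeast_support
  refine ⟨fun v => Finset.sum_nonneg fun q _ => p.nonneg q, ?_, (A m).1, (A m).2, fun v hv => ?_⟩
  · obtain ⟨v, hv⟩ := (A m).nonempty
    exact ⟨v, unionWeight_ne_zero.2 ⟨m, hm, hv⟩⟩
  · obtain ⟨q, hq, hv⟩ := unionWeight_ne_zero.1 hv
    exact hA (hle q hq) hv

/-- A monotone map `A` to the face poset of `K` induces a map from the realisation of the poset to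
the realisation of `K`, whose value at `p` has support the union of the simplices `A q` for `q` in
the support of `p`. -/
noncomputable def unionMap (A : Q → FacePoset K) (hA : Monotone A) :
    C(Realization (orderComplex Q), Realization K) where
  toFun p := ofWeights _ (isWeight_unionWeight hA p)
  continuous_toFun := by
    classical
    refine continuous_iff.2 fun s hs => ?_
    refine continuous_ofWeights _ (s.biUnion fun q => (A q).1) (fun p v hv => ?_) fun v => ?_
    · obtain ⟨q, hq, hv⟩ := unionWeight_ne_zero.1 hv
      exact Finset.mem_biUnion.2 ⟨q, p.2 hq, hv⟩
    · have : (fun p : ClosedSimplex (orderComplex Q) s => unionWeight A p.1 v) = fun p =>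
          ∑ q ∈ s with v ∈ (A q).1, p.1.coord q := by
        funext p
        refine Finset.sum_subset (Finset.filter_subset_filter _ p.2) fun q hq hqp => ?_
        exact Finsupp.notMem_support_iff.1 fun h =>
          hqp (Finset.mem_filter.2 ⟨h, (Finset.mem_filter.1 hq).2⟩)
      rw [this]
      exact continuous_finsetSum _ fun q _ => continuous_closedSimplex_coord s q

theorem mem_support_unionMap (hA : Monotone A) {p : Realization (orderComplex Q)} {v : ι} :
    v ∈ (unionMap A hA p).coord.support ↔ ∃ q ∈ p.coord.support, v ∈ (A q).1 :=
  (mem_support_ofWeights (isWeight_unionWeight hA p)).trans unionWeight_ne_zero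

theorem support_unionMap_subset (hA : Monotone A) {p : Realization (orderComplex Q)} {m : Q}
    (hm : ∀ q ∈ p.coord.support, m ≤ q) : (unionMap A hA p).coord.support ⊆ (A m).1 :=
  fun _ hv =>
    let ⟨q, hq, hv⟩ := (mem_support_unionMap hA).1 hv
    hA (hm q hq) hv

/-- Vertices contributed by the top of the support have the largest coordinates. -/
theorem unionMap_coord_le (hA : Monotone A) {p : Realization (orderComplex Q)} {m : Q}
    (hm : ∀ q ∈ p.coord.support, q ≤ m) {u v : ι} (hv : v ∈ (A m).1) :
    (unionMap A hA p).coord u ≤ (unionMap A hA p).coord v := by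
  classical
  refine (ofWeights_coord_le (isWeight_unionWeight hA p)).2 ?_
  rw [unionWeight, unionWeight]
  refine Finset.sum_le_sum_of_subset_of_nonneg (fun q hq => ?_) fun q _ _ => p.nonneg q
  have hq := (Finset.mem_filter.1 hq).1
  exact Finset.mem_filter.2 ⟨hq, hA (hm q hq) hv⟩

theorem unionMap_smul {G : Type*} [Group G] [MulAction G Q]
    [CovariantClass G Q HSMul.hSMul LE.le] [MulAction G ι] [IsSimplicialAction G K]
    (hA : Monotone A) (hAG : ∀ (g : G) q, A (g • q) = g • A q) (g : G)
    (p : Realization (orderComplex Q)) : unionMap A hA (g • p) = g • unionMap A hA p := by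
  classical
  refine (smul_ofWeights g (isWeight_unionWeight hA p) (isWeight_unionWeight hA (g • p))
    fun v => ?_).symm
  rw [unionWeight, unionWeight, support_smul, Finset.filter_map, Finset.sum_map]
  refine Finset.sum_congr ?_ fun q _ => smul_coord_smul g p q
  ext q
  simp [hAG, FacePoset.smul_mem_smul]

end UnionMap

/-! ### Barycentric subdivision through superlevel sets. -/

section Subdivision

open scoped NNReal

variable {ι : Type*} {K : PreAbstractSimplicialComplex ι}

open Classical in
/-- The difference between the smallest coordinate in a simplex and the largest one outside it. -/
noncomputable def levelWeight (p : Realization K) (s : FacePoset K) : ℝ :=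
  ((s.1.inf' s.nonempty p.nncoord - (p.coord.support \ s.1).sup p.nncoord : ℝ≥0) : ℝ)

/-- Subtraction in `ℝ≥0` is truncated, so a nonzero weight forces a strict gap between the
coordinates in `s` and those outside. -/
theorem coord_lt_of_levelWeight {p : Realization K} {s : FacePoset K} (h : p.levelWeight s ≠ 0)
    {u v : ι} (hu : u ∈ s.1) (hv : v ∉ s.1) : p.coord v < p.coord u := by
  classical
  have hlt : (p.coord.support \ s.1).sup p.nncoord < s.1.inf' s.nonempty p.nncoord := by
    rw [← tsub_pos_iff_lt, pos_iff_ne_zero]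
    exact fun h' => h (NNReal.coe_eq_zero.2 h')
  have hle : p.nncoord v ≤ (p.coord.support \ s.1).sup p.nncoord := by
    by_cases hvp : v ∈ p.coord.support
    · exact Finset.le_sup (Finset.mem_sdiff.2 ⟨hvp, hv⟩)
    · rw [nncoord_eq_zero hvp]
      exact zero_le
  exact NNReal.coe_lt_coe.2 ((hle.trans_lt hlt).trans_le (Finset.inf'_le _ hu))

theorem subset_support_of_levelWeight {p : Realization K} {s : FacePoset K}
    (h : p.levelWeight s ≠ 0) : s.1 ⊆ p.coord.support := by
  classical
  intro u hu
  have hlt : 0 < s.1.inf' s.nonempty p.nncoord := by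
    rw [pos_iff_ne_zero]
    intro h0
    simp [levelWeight, h0] at h
  exact nncoord_pos.1 (hlt.trans_le (Finset.inf'_le _ hu))

/-- Strict superlevel sets of one function are nested, so the simplices of nonzero weight form a
chain; the support of `p` is always one of them. -/
theorem isWeight_levelWeight (p : Realization K) :
    IsWeight (orderComplex (FacePoset K)) p.levelWeight := by
  classical
  have hne : ∃ s, p.levelWeight s ≠ 0 := by
    let s : FacePoset K := ⟨_, p.support_mem⟩
    have hs : p.coord.support \ s.1 = ∅ := Finset.sdiff_self _
    refine ⟨s, NNReal.coe_ne_zero.2 (ne_of_gt ?_)⟩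
    rw [hs, Finset.sup_empty, bot_eq_zero, tsub_zero, Finset.lt_inf'_iff]
    exact fun v hv => nncoord_pos.2 hv
  let S : Finset (FacePoset K) :=
    (p.coord.support.powerset.subtype (· ∈ K)).filter (p.levelWeight · ≠ 0)
  have hS : ∀ s, s ∈ S ↔ p.levelWeight s ≠ 0 := fun s =>
    Finset.mem_filter.trans (and_iff_right_of_imp fun h =>
      Finset.mem_subtype.2 (Finset.mem_powerset.2 (subset_support_of_levelWeight h)))
  refine ⟨fun s => NNReal.coe_nonneg _, hne, S, ⟨?_, ?_⟩, fun s => (hS s).2⟩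
  · exact hne.imp fun s => (hS s).2
  · intro s hs t ht _
    have hs := (hS s).1 hs
    have ht := (hS t).1 ht
    by_cases hst : s.1 ⊆ t.1
    · exact Or.inr hst
    · obtain ⟨u, hus, hut⟩ := Finset.not_subset.1 hst
      refine Or.inl fun v hvt => ?_
      by_contra hvs
      exact lt_asymm (coord_lt_of_levelWeight hs hus hvs) (coord_lt_of_levelWeight ht hvt hut)

/-- The map from a realisation to its barycentric subdivision, supported at `p` on the strict
superlevel sets of the barycentric coordinates of `p`. -/
noncomputable def subdivide : C(Realization K, Realization (orderComplex (FacePoset K))) where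
  toFun p := ofWeights _ p.isWeight_levelWeight
  continuous_toFun := by
    classical
    refine continuous_iff.2 fun s hs => ?_
    refine continuous_ofWeights _ (s.powerset.subtype (· ∈ K)) (fun p t ht => ?_) fun t => ?_
    · exact Finset.mem_subtype.2
        (Finset.mem_powerset.2 ((subset_support_of_levelWeight ht).trans p.2))
    · have : (fun p : ClosedSimplex K s => p.1.levelWeight t) = fun p =>
          ((t.1.inf' t.nonempty (fun v => p.1.nncoord v) -
            (s \ t.1).sup (fun v => p.1.nncoord v) : ℝ≥0) : ℝ) := by
        funext p
        change ((_ - _ : ℝ≥0) : ℝ) = _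
        congr 2
        refine le_antisymm (Finset.sup_mono (Finset.sdiff_subset_sdiff p.2 subset_rfl))
          (Finset.sup_le fun v hv => ?_)
        by_cases hvp : v ∈ p.1.coord.support
        · exact Finset.le_sup (Finset.mem_sdiff.2 ⟨hvp, (Finset.mem_sdiff.1 hv).2⟩)
        · rw [nncoord_eq_zero hvp]
          exact zero_le
      rw [this]
      have hc : ∀ v, Continuous fun p : ClosedSimplex K s => p.1.nncoord v := fun v =>
        (continuous_nncoord v).comp (continuous_closedSimplex_val hs)
      exact NNReal.continuous_coe.comp ((Continuous.finset_inf'_apply _ fun v _ => hc v).sub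
        (Continuous.finset_sup_apply fun v _ => hc v))

theorem mem_support_subdivide {p : Realization K} {s : FacePoset K} :
    s ∈ (subdivide p).coord.support ↔ p.levelWeight s ≠ 0 :=
  mem_support_ofWeights p.isWeight_levelWeight

variable {G : Type*} [Group G] [MulAction G ι] [IsSimplicialAction G K]

theorem subdivide_smul (g : G) (p : Realization K) : subdivide (g • p) = g • subdivide p := by
  classical
  refine (smul_ofWeights g p.isWeight_levelWeight (g • p).isWeight_levelWeight fun s => ?_).symm
  have hmap : ∀ v, ((g • p).nncoord ∘ (MulAction.toPerm g).toEmbedding) v = p.nncoord v :=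
    fun v => nncoord_smul_smul g p v
  simp only [levelWeight, FacePoset.smul_val, support_smul, ← Finset.map_sdiff, Finset.sup_map,
    Finset.inf'_map, funext hmap]

/-- Barycentric subdivision is a homotopy inverse of the canonical map from the realisation of the
face poset. -/
theorem gHomotopic_unionMap_subdivide :
    GHomotopic G ((unionMap (id : FacePoset K → FacePoset K) monotone_id).comp subdivide)
      (ContinuousMap.id (Realization K)) := by
  have hsub : ∀ p : Realization K, (unionMap (id : FacePoset K → FacePoset K) monotone_id
      (subdivide p)).coord.support ⊆ p.coord.support := fun p v hv => by
    obtain ⟨s, hs, hv⟩ := (mem_support_unionMap monotone_id).1 hv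
    exact subset_support_of_levelWeight (mem_support_subdivide.1 hs) hv
  refine GHomotopic.symm (gHomotopic_id _ (fun g p => ?_)
    (fun p => ⟨_, p.support_mem, Finset.Subset.refl _, hsub p⟩)
    fun s _ => ⟨s, fun p hp => (hsub p).trans hp⟩)
  simp only [ContinuousMap.comp_apply]
  rw [subdivide_smul, unionMap_smul monotone_id fun _ _ => rfl]

end Subdivision

/-! ### Closed stars as contractible carriers. -/

section Star

variable {ι : Type*} {K : PreAbstractSimplicialComplex ι}

open Classical in
/-- The closed star of a simplex. -/
def closedStar (s : FacePoset K) : PreAbstractSimplicialComplex ι where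
  faces := {t | t.Nonempty ∧ t ∪ s.1 ∈ K}
  isRelLowerSet_faces := fun _ ht =>
    ⟨ht.1, fun _ hut hu => ⟨hu, mem_of_subset ht.2 (Finset.union_subset_union_left hut)
      (hu.mono Finset.subset_union_left)⟩⟩

theorem mem_closedStar [DecidableEq ι] {s : FacePoset K} {t : Finset ι} :
    t ∈ closedStar s ↔ t.Nonempty ∧ t ∪ s.1 ∈ K := by
  change t.Nonempty ∧ _ ↔ _
  congr!

variable {G : Type*} [Group G] [MulAction G ι] [IsSimplicialAction G K]

instance (s : FacePoset K) : IsSimplicialAction (MulAction.stabilizer G s) (closedStar s) where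
  map_mem g t ht := by
    classical
    rw [mem_closedStar] at ht ⊢
    refine ⟨ht.1.map, ?_⟩
    have hg : s.1.map (MulAction.toPerm (g : G)).toEmbedding = s.1 := congrArg Subtype.val g.2
    have := IsSimplicialAction.map_mem (g : G) _ ht.2
    rwa [Finset.map_union, hg] at this

/-- The closed star of a simplex is equivariantly contractible to the barycenter. -/
theorem gContractible_closedStar (s : FacePoset K) :
    GContractible (MulAction.stabilizer G s) (Realization (closedStar s)) := by
  classical
  have hs : s.1 ∈ closedStar s := mem_closedStar.2 ⟨s.nonempty, by simpa using s.2⟩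
  let w : ι → ℝ := fun v => if v ∈ s.1 then 1 else 0
  have hw : IsWeight (closedStar s) w := by
    refine ⟨fun v => ?_, ?_, s.1, hs, fun v hv => ?_⟩
    · simp only [w]
      split_ifs <;> norm_num
    · obtain ⟨v, hv⟩ := s.nonempty
      exact ⟨v, by simp [w, hv]⟩
    · by_contra h
      simp [w, h] at hv
  let b : Realization (closedStar s) := ofWeights w hw
  have hbs : b.coord.support ⊆ s.1 := fun v hv => by
    by_contra h
    exact (mem_support_ofWeights hw).1 hv (if_neg h)
  -- The stabiliser permutes the vertices of `s`, and the weights are uniform on them.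
  have hb : ∀ g : MulAction.stabilizer G s, g • b = b := fun g => by
    refine smul_ofWeights g hw hw fun v => ?_
    have hg : (g : G) • s = s := g.2
    have : g • v ∈ s.1 ↔ v ∈ s.1 := by
      have h := FacePoset.smul_mem_smul (g := (g : G)) (s := s) (v := v)
      rwa [hg] at h
    simp only [w, this]
  have hcontr : GHomotopic (MulAction.stabilizer G s)
      (ContinuousMap.id (Realization (closedStar s))) (ContinuousMap.const _ b) := by
    refine gHomotopic_id _ (fun g _ => (hb g).symm) (fun p => ?_) fun t _ => ⟨s.1, fun _ _ => hbs⟩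
    refine ⟨p.coord.support ∪ s.1, ?_, Finset.subset_union_left,
      hbs.trans Finset.subset_union_right⟩
    have := mem_closedStar.1 p.support_mem
    rw [mem_closedStar, Finset.union_assoc, Finset.union_self]
    exact ⟨this.1.mono Finset.subset_union_left, this.2⟩
  refine ⟨ContinuousMap.const _ PUnit.unit, ContinuousMap.const _ b, fun _ _ => rfl,
    fun g _ => (hb g).symm, hcontr.symm, ?_⟩
  exact ⟨ContinuousMap.Homotopy.refl (ContinuousMap.id PUnit), fun _ _ _ => rfl⟩

/-- The points of the realisation whose support spans a simplex together with `s`. -/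
def starCarrier (s : FacePoset K) : Set (Realization K) :=
  Set.range (mapEmbedding (K' := closedStar s) (K := K) (Function.Embedding.refl ι)
    fun t ht => by
      classical
      rw [Finset.map_refl]
      exact mem_of_subset (mem_closedStar.1 ht).2 Finset.subset_union_left (mem_closedStar.1 ht).1)

theorem mem_starCarrier [DecidableEq ι] {s : FacePoset K} {p : Realization K} :
    p ∈ starCarrier s ↔ p.coord.support ∪ s.1 ∈ K := by
  rw [starCarrier, mem_range_mapEmbedding]
  simp only [Finset.map_refl, exists_eq_right, mem_closedStar, and_iff_right p.support_nonempty]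

theorem isClosed_starCarrier (s : FacePoset K) : IsClosed (starCarrier s) :=
  (isClosedEmbedding_mapEmbedding _ _).isClosed_range

theorem monotone_starCarrier : Monotone (starCarrier : FacePoset K → Set (Realization K)) := by
  classical
  intro s t hst p hp
  rw [mem_starCarrier] at hp ⊢
  exact mem_of_subset hp (Finset.union_subset_union_right hst)
    (p.support_nonempty.mono Finset.subset_union_left)

theorem smul_mem_starCarrier (g : G) (s : FacePoset K) (p : Realization K)
    (hp : p ∈ starCarrier s) : g • p ∈ starCarrier (g • s) := by
  classical
  rw [mem_starCarrier] at hp ⊢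
  rw [support_smul, FacePoset.smul_val, ← Finset.map_union]
  exact IsSimplicialAction.map_mem g _ hp

theorem exists_isEquivariantContraction_starCarrier :
    ∃ H, IsEquivariantContraction G (starCarrier : FacePoset K → Set (Realization K)) H :=
  exists_isEquivariantContraction _ smul_mem_starCarrier fun s =>
    exists_contraction_of_isClosedEmbedding (gContractible_closedStar (G := G) s)
      (isClosedEmbedding_mapEmbedding _ _) fun _ p =>
        mapEmbedding_smul _ _ (fun _ => rfl) p

end Star

end Realization

/-! ### Carriers from the cover, and the nerve theorem. -/

namespace GCover

open Realization PreAbstractSimplicialComplex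

theorem mem_inter {G X : Type*} [Group G] [MulAction G X] {σ : Finset (Set X)} {x : X} :
    x ∈ inter G σ ↔ ∀ U ∈ σ, x ∈ U :=
  Set.mem_iInter₂

variable {G X : Type*} [Group G] [PartialOrder X] [MulAction G X]

theorem map_inter_mem_orderComplex (σ : Finset (Set X)) (s : Finset (inter G σ))
    (hs : s ∈ orderComplex (inter G σ)) :
    s.map (Function.Embedding.subtype _) ∈ orderComplex X := by
  refine ⟨hs.1.map, ?_⟩
  rw [Finset.coe_map]
  rintro _ ⟨x, hx, rfl⟩ _ ⟨y, hy, rfl⟩ _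
  exact hs.2.total hx hy

/-- The points of `|X|` in the realisation of the intersection of the members of `σ`. -/
def interCarrier (G : Type*) {X : Type*} [Group G] [PartialOrder X] [MulAction G X]
    (σ : Finset (Set X)) : Set (Realization (orderComplex X)) :=
  Set.range (mapEmbedding _ (map_inter_mem_orderComplex (G := G) σ))

theorem mem_interCarrier {σ : Finset (Set X)} {p : Realization (orderComplex X)} :
    p ∈ interCarrier G σ ↔ ∀ x ∈ p.coord.support, ∀ U ∈ σ, x ∈ U := by
  classical
  rw [interCarrier, mem_range_mapEmbedding]
  constructor
  · rintro ⟨s, _, hs⟩ x hx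
    rw [← hs] at hx
    obtain ⟨y, _, rfl⟩ := Finset.mem_map.1 hx
    exact mem_inter.1 y.2
  · intro h
    have hmap : (p.coord.support.subtype (· ∈ inter G σ)).map (Function.Embedding.subtype _) =
        p.coord.support := Finset.subtype_map_of_mem fun x hx => mem_inter.2 (h x hx)
    refine ⟨_, ⟨?_, ?_⟩, hmap⟩
    · rw [← Finset.map_nonempty (f := Function.Embedding.subtype _), hmap]
      exact p.support_nonempty
    · intro x hx y hy _
      exact p.isChain_support.total (Finset.mem_subtype.1 hx) (Finset.mem_subtype.1 hy)

theorem isClosed_interCarrier (σ : Finset (Set X)) : IsClosed (interCarrier G σ) :=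
  (isClosedEmbedding_mapEmbedding _ _).isClosed_range

variable (𝒰 : GCover G X)

theorem monotone_interCarrier : Monotone fun σ : FacePoset 𝒰.nerve => interCarrier G σ.1 := by
  intro σ τ h p hp
  rw [mem_interCarrier] at hp ⊢
  exact fun x hx U hU => hp x hx U (h hU)

variable (hfin : ∀ x : X, {U ∈ 𝒰.sets | x ∈ U}.Finite)

/-- The simplex of the nerve formed by all members of the cover that contain a given point. -/
noncomputable def pointStar (x : X) : FacePoset 𝒰.nerve :=
  ⟨(hfin x).toFinset, by
    refine ⟨?_, fun U hU => ((hfin x).mem_toFinset.1 hU).1, x,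
      Set.mem_iInter₂.2 fun U hU => ((hfin x).mem_toFinset.1 hU).2⟩
    obtain ⟨U, hU, hx⟩ := Set.mem_sUnion.1 (𝒰.sUnion_eq.ge (Set.mem_univ x))
    exact ⟨U, (hfin x).mem_toFinset.2 ⟨hU, hx⟩⟩⟩

theorem mem_pointStar {x : X} {U : Set X} : U ∈ (𝒰.pointStar hfin x).1 ↔ U ∈ 𝒰.sets ∧ x ∈ U :=
  (hfin x).mem_toFinset

/-- Members of the cover are lower sets, so passing to a smaller point can only enlarge the set of
members containing it. -/
theorem monotone_pointStar : Monotone (𝒰.pointStar hfin) := by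
  intro x y hxy U hU
  rw [mem_pointStar] at hU ⊢
  exact ⟨hU.1, 𝒰.isLowerSet U hU.1 hxy hU.2⟩

theorem pointStar_smul (g : G) (x : X) : 𝒰.pointStar hfin (g • x) = g • 𝒰.pointStar hfin x := by
  refine Subtype.ext (Finset.ext fun U => ?_)
  rw [mem_pointStar, FacePoset.mem_smul, mem_pointStar, Set.mem_inv_smul_set_iff]
  exact and_congr_left fun _ => ⟨𝒰.smul_mem g⁻¹ U, fun h => by simpa using 𝒰.smul_mem g _ h⟩

variable [CovariantClass G X HSMul.hSMul LE.le]

theorem smul_mem_interCarrier (g : G) (σ : FacePoset 𝒰.nerve) (p : Realization (orderComplex X))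
    (hp : p ∈ interCarrier G σ.1) : g • p ∈ interCarrier G (g • σ).1 := by
  rw [mem_interCarrier] at hp ⊢
  intro x hx U hU
  exact Set.smul_mem_smul_set_iff.1 (hp _ (mem_support_smul.1 hx) _ (FacePoset.mem_smul.1 hU))

theorem exists_isEquivariantContraction_interCarrier (h : 𝒰.IsGContractible) :
    ∃ H, IsEquivariantContraction G (fun σ : FacePoset 𝒰.nerve => interCarrier G σ.1) H := by
  refine exists_isEquivariantContraction _ 𝒰.smul_mem_interCarrier fun σ => ?_
  obtain ⟨H, h1, h2, h3, h4, h5, h6⟩ := exists_contraction_of_isClosedEmbedding (h σ.1 σ.2)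
    (isClosedEmbedding_mapEmbedding _ (map_inter_mem_orderComplex (G := G) σ.1))
    fun g p => mapEmbedding_smul _ _ (fun _ => rfl) p
  refine ⟨H, h1, h2, h3, h4, h5, fun g hg => h6 g ?_⟩
  have := congrArg (fun s : Finset (Set X) => (s : Set (Set X))) (congrArg Subtype.val hg)
  simp only [FacePoset.smul_val, Finset.coe_map] at this
  exact this

end GCover

open Realization GCover PreAbstractSimplicialComplex in
theorem theorem7p2 {G X : Type*} [Group G] [PartialOrder X] [MulAction G X]
    [CovariantClass G X HSMul.hSMul LE.le] (𝒰 : GCover G X)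
    (hfin : ∀ x : X, {U ∈ 𝒰.sets | x ∈ U}.Finite)
    (h𝒰 : 𝒰.IsGContractible) :
    GHomotopyEquivalent G (Realization 𝒰.nerve) (Realization (orderComplex X)) := by
  classical
  obtain ⟨H, hH⟩ := 𝒰.exists_isEquivariantContraction_interCarrier h𝒰
  have hmono := 𝒰.monotone_interCarrier
  have hcl : ∀ σ : FacePoset 𝒰.nerve, IsClosed (interCarrier G σ.1) := fun σ =>
    isClosed_interCarrier σ.1
  have hstar := 𝒰.monotone_pointStar hfin
  obtain ⟨h, hhG, hh⟩ := exists_carried_map hmono hcl hH 𝒰.smul_mem_interCarrier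
  let φ := unionMap (𝒰.pointStar hfin) hstar
  have hφG : ∀ (g : G) p, φ (g • p) = g • φ p := unionMap_smul hstar (𝒰.pointStar_smul hfin)
  let ψ := h.comp subdivide
  have hψG : ∀ (g : G) p, ψ (g • p) = g • ψ p := fun g p => by
    simp only [ψ, ContinuousMap.comp_apply, subdivide_smul, hhG]
  refine ⟨ψ, φ, hψG, hφG, ?_, ?_⟩
  · -- the composite on the nerve is compared with the subdivision through closed stars
    obtain ⟨H', hH'⟩ := exists_isEquivariantContraction_starCarrier (G := G) (K := 𝒰.nerve)
    have key : GHomotopic G (φ.comp h) (unionMap (id : FacePoset 𝒰.nerve → _) monotone_id) := by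
      refine gHomotopic_of_carried monotone_starCarrier isClosed_starCarrier hH' (fun g p => ?_)
        (unionMap_smul monotone_id fun _ _ => rfl) (fun p σ hσ => ?_) fun p σ hσ => ?_
      · simp only [ContinuousMap.comp_apply, hhG, hφG]
      -- The simplex `pointStar x` of the least vertex `x` of `h p` contains the support of `φ (h
      -- p)`. It also contains `σ`, because `h p` lies in the carrier of `σ`.
      · obtain ⟨x, hx, hle⟩ := (h p).exists_isLeast_support
        have hσx : σ.1 ⊆ (𝒰.pointStar hfin x).1 := fun U hU =>
          (𝒰.mem_pointStar hfin).2 ⟨σ.2.2.1 U hU, mem_interCarrier.1 (hh p σ hσ) x hx U hU⟩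
        exact mem_starCarrier.2 (mem_of_subset (𝒰.pointStar hfin x).2
          (Finset.union_subset (support_unionMap_subset hstar hle) hσx)
          ((φ (h p)).support_nonempty.mono Finset.subset_union_left))
      -- In the reversed order the least face `m` is the largest simplex, containing both `σ` and
      -- the support of the image.
      · obtain ⟨m, hm, hle⟩ := p.exists_isLeast_support
        exact mem_starCarrier.2 (mem_of_subset m.2
          (Finset.union_subset (support_unionMap_subset monotone_id hle) (hσ m hm))
          ((support_nonempty _).mono Finset.subset_union_left))
    exact (key.comp_right subdivide subdivide_smul).trans gHomotopic_unionMap_subdivide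
  -- The contractions are pulled back along the equivariant map `pointStar`.
  · have hH₂ : IsEquivariantContraction G (fun x => interCarrier G (𝒰.pointStar hfin x).1)
        fun x => H (𝒰.pointStar hfin x) :=
      ⟨fun _ => hH.nonempty _, fun _ => hH.mapsTo _, fun _ => hH.apply_of_notMem _,
        fun _ => hH.zero _, fun _ => hH.one _, fun _ => hH.continuousOn _,
        fun g x s y => by rw [pointStar_smul, hH.smul]⟩
    refine gHomotopic_of_carried (hmono.comp hstar) (fun x => hcl _) hH₂ (fun g p => ?_)
      (fun _ _ => rfl) (fun p x hx => ?_) fun p x hx => ?_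
    · simp only [ContinuousMap.comp_apply, hφG, hψG]
    -- If `x` bounds the support of `p`, members containing `x` have maximal coordinate in `φ p`.
    -- They therefore belong to every strict superlevel set `σ` in the support of the subdivision,
    -- so that `σ ≤ pointStar x`.
    · refine hh _ _ fun σ hσ U hU => ?_
      have hσ := mem_support_subdivide.1 hσ
      by_contra hUσ
      obtain ⟨V, hV⟩ := σ.nonempty
      exact (coord_lt_of_levelWeight hσ hV hUσ).not_ge (unionMap_coord_le hstar hx hU)
    · refine mem_interCarrier.2 fun y hy U hU => ?_
      rw [mem_pointStar] at hU
      exact 𝒰.isLowerSet U hU.1 (hx y hy) hU.2
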